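/- Setting. Let $d\ge 0$ and $d_1\ge 2d+1$ be integers and let $\xi\in[-\pi,\pi]$, $\omega=e^{-i\xi}$. Let $f:\mathbb R\to\mathbb R$ be $2\pi$-periodic, with $d_1$ continuous derivatives on $\mathbb R\setminus(\xi+2\pi\mathbb Z)$, such that the one-sided limits of $f,f',\dots,f^{(d_1)}$ at $\xi$ exist; put $A_l=f^{(l)}(\xi^+)-f^{(l)}(\xi^-)$ for $0\le l\le d_1$ and assume $A_0\neq0$. Let $c_k(g)=\frac1{2\pi}\int_{-\pi}^{\pi}g(t)e^{-ikt}\,dt$. Let $V_n(\cdot\,;\xi)$ be the $2\pi$-periodic function equal to $-\frac{(2\pi)^n}{(n+1)!}B_{n+1}\!\left(\frac{x-\xi}{2\pi}\right)$ for $\xi\le x<\xi+2\pi$ ($B_n$ the Bernoulli polynomials), let $\Psi^*=f-\sum_{l=0}^{d_1}A_lV_l(\cdot\,;\xi)$, and let $R$ be a constant such that $|c_n(\Psi^*)|\le R\,n^{-d_1-2}$ for all integers $n\ge1$. Put $$H=\max\Bigl(1,\sum_{l=0}^{d}|A_l|\Bigr)+\max\Bigl(1,\sum_{l=d+1}^{d_1}|A_l|\Bigr)+R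 .$$ For $k\in\mathbb N$ let $r_k=2\pi(ik)^{d+1}c_k(f)$ and $$q_k^d(z)=\sum_{j=0}^{d+1}(-1)^j\binom{d+1}{j}r_{k+j}\,z^{d+1-j}.$$ Let $\phi_1,\dots,\phi_d$ be the roots of the Laguerre polynomial $L_d^{(1)}(x)=\sum_{m=0}^{d}\binom{d+1}{d-m}\frac{(-x)^m}{m!}$, which are real and simple, ordered so that $|\phi_1|<\dots<|\phi_d|$. Let $T^{-1}(u)=\frac{\omega}{u+1}$, $y_0=\omega$ and $y_i=T^{-1}(-\phi_i/k)$ for $1\le i\le d$. Theorem. There is a constant $c>0$ depending only on $d$ and, for every $J>0$, there are positive constants $C_0,C_1,K$ depending only on $d,d_1,J$ such that for every $f$ as above with $|A_0|\ge J$ and every integer $k>K\,H$ the following hold. 1. Each $y_i$ ($0\le i\le d$) lies on the ray from $0$ through $\omega$ with $|y_i|\ge1$, and $|y_i-y_j|\ge c\,k^{-1}$ for $0\le i<j\le d$. 2. $q_k^d$ has degree $d+1$; if $\kappa_0,\dots,\kappa_d$ are its roots, listed with multiplicity so that $|\kappa_0|\le\dots\le|\kappa_d|$, then $|\kappa_i-y_i|\le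 C_1H\,k^{-2}$ for $i=1,\dots,d$. 3. $|\kappa_0-\omega|\le C_0H\,k^{-d-2}$. 4. $\kappa_0$ is the unique root of $q_k^d$ closest to the unit circle. Hence the root $\widetilde\omega$ of $q_k^d$ closest to the unit circle, which the reconstruction algorithm selects, satisfies $|\widetilde\omega-\omega|\le C_0H\,k^{-d-2}$. -/

import Mathlib

noncomputable section

namespace FourierJump

/-- The Fourier coefficient `c_k(f) = (1 / 2π) ∫_{-π}^{π} f(t) e^{-ikt} dt`. -/
def fourierCoefficient (f : ℝ → ℝ) (k : ℤ) : ℂ :=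
  (1 / (2 * (Real.pi : ℂ))) *
    ∫ t in (-Real.pi)..Real.pi, (f t : ℂ) * Complex.exp (-(Complex.I * (k : ℂ) * (t : ℂ)))

/-- The coefficients agree with Mathlib's Fourier coefficients on the interval `[-π, π]`. -/
theorem fourierCoefficient_eq_fourierCoeffOn (f : ℝ → ℝ) (k : ℤ) (h : -Real.pi < Real.pi) :
    fourierCoefficient f k = fourierCoeffOn h (fun t => (f t : ℂ)) k := by
  rw [fourierCoeffOn_eq_integral, fourierCoefficient, Complex.real_smul]
  congr 1
  · push_cast; ring
  · apply intervalIntegral.integral_congr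
    intro t _
    simp only [fourier_coe_apply, smul_eq_mul]
    rw [mul_comm]
    congr 2
    have : (Real.pi : ℂ) ≠ 0 := by exact_mod_cast Real.pi_ne_zero
    push_cast
    field_simp
    ring

/-- `f` is (the `2π`-periodic extension of) a function whose only jump, modulo `2π`, is at `ξ`:
it has `n` continuous derivatives away from `ξ`, the one-sided limits at `ξ` of the derivatives
of order `0, …, n` exist, and `A l` is the jump `f^{(l)}(ξ⁺) - f^{(l)}(ξ⁻)` for `l ≤ n`.
The value of `f` at `ξ` itself is irrelevant. -/
structure HasSingleJump (f : ℝ → ℝ) (ξ : ℝ) (n : ℕ) (A : ℕ → ℝ) : Prop where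
  periodic : Function.Periodic f (2 * Real.pi)
  contDiffOn : ContDiffOn ℝ n f (Set.Ioo ξ (ξ + 2 * Real.pi))
  jump : ∀ l ≤ n, ∃ a b : ℝ,
    Filter.Tendsto (iteratedDeriv l f) (nhdsWithin ξ (Set.Ioi ξ)) (nhds a) ∧
    Filter.Tendsto (iteratedDeriv l f) (nhdsWithin ξ (Set.Iio ξ)) (nhds b) ∧
    A l = a - b

/-- The `2π`-periodic function `V_n(x; ξ)` that equals
`-((2π)^n / (n+1)!) B_{n+1}((x - ξ) / 2π)` for `ξ ≤ x < ξ + 2π`, where `B_{n+1}` is the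
Bernoulli polynomial. -/
def bernoulliSpline (n : ℕ) (ξ x : ℝ) : ℝ :=
  -((2 * Real.pi) ^ n / ((n + 1).factorial : ℝ)) *
    bernoulliFun (n + 1) (Int.fract ((x - ξ) / (2 * Real.pi)))

/-- The piecewise polynomial `Φ_n = ∑_{l=0}^{n} A_l V_l(·; ξ)` of degree `n + 1` at most that
has the jumps `A_0, …, A_n` at `ξ`. -/
def singularPart (n : ℕ) (ξ : ℝ) (A : ℕ → ℝ) (x : ℝ) : ℝ :=
  ∑ l ∈ Finset.range (n + 1), A l * bernoulliSpline l ξ x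

/-- The smooth component `Ψ* = f - Φ_n`. -/
def smoothPart (f : ℝ → ℝ) (n : ℕ) (ξ : ℝ) (A : ℕ → ℝ) (x : ℝ) : ℝ :=
  f x - singularPart n ξ A x

/-- `H = A* + A** + R`, where `A* = max(1, ∑_{l=0}^{d} |A_l|)` and
`A** = max(1, ∑_{l=d+1}^{d₁} |A_l|)`. -/
def sizeH (d d₁ : ℕ) (A : ℕ → ℝ) (R : ℝ) : ℝ :=
  max 1 (∑ l ∈ Finset.Icc 0 d, |A l|) + max 1 (∑ l ∈ Finset.Icc (d + 1) d₁, |A l|) + R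

/-- `r_k = 2π (ik)^{d+1} c_k(f)`. -/
def scaledCoeff (d : ℕ) (f : ℝ → ℝ) (k : ℕ) : ℂ :=
  2 * (Real.pi : ℂ) * (Complex.I * (k : ℂ)) ^ (d + 1) * fourierCoefficient f (k : ℤ)

/-- The polynomial `q_k^d(z) = ∑_{j=0}^{d+1} (-1)^j binom(d+1, j) r_{k+j} z^{d+1-j}`. -/
def eliminant (d : ℕ) (f : ℝ → ℝ) (k : ℕ) : Polynomial ℂ :=
  ∑ j ∈ Finset.range (d + 2),
    Polynomial.monomial (d + 1 - j)
      ((-1 : ℂ) ^ j * ((d + 1).choose j : ℂ) * scaledCoeff d f (k + j))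

/-- The generalized Laguerre polynomial
`L_n^{(α)}(x) = ∑_{m=0}^{n} binom(n + α, n - m) (-x)^m / m!`, for integers `α ≥ 0`. -/
def laguerre (α n : ℕ) : Polynomial ℝ :=
  ∑ m ∈ Finset.range (n + 1),
    Polynomial.monomial m (((n + α).choose (n - m) : ℝ) * (-1) ^ m / (m.factorial : ℝ))

/-- `ω = e^{-iξ}`. -/
def jumpPoint (ξ : ℝ) : ℂ := Complex.exp (-(Complex.I * (ξ : ℂ)))

/-- The inverse `T⁻¹(u) = ω / (u + 1)` of the map `T(z) = ω / z - 1`. -/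
def invT (ω u : ℂ) : ℂ := ω / (u + 1)

/-- The points `y_0 = ω` and `y_i = T⁻¹(-φ_i / k)` for `i = 1, …, d`. -/
def node {d : ℕ} (ω : ℂ) (φ : Fin d → ℝ) (k : ℕ) : Fin (d + 1) → ℂ :=
  Fin.cons ω (fun i => invT ω (-(φ i : ℂ) / (k : ℂ)))

/-- `w` is a possible output of the location step of the reconstruction algorithm with
`M = k`: a root of `q_k^d` at the smallest distance from the unit circle. (The distance of a
complex number `z` from the unit circle is `| |z| - 1 |`.) -/
def IsLocationEstimate (d : ℕ) (f : ℝ → ℝ) (k : ℕ) (w : ℂ) : Prop :=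
  (eliminant d f k).IsRoot w ∧
    ∀ z : ℂ, (eliminant d f k).IsRoot z → |‖w‖ - 1| ≤ |‖z‖ - 1|

end FourierJump

end

/-!
The Bernoulli spline `V_l` has the Fourier coefficients `ω ^ k / (2π (ik) ^ (l + 1))`, so the
scaled coefficient `r_m` equals `ω ^ m (∑ l, A_l (i m) ^ (d - l))` up to `O(R m ^ (-d - 2))`; this
uses `d₁ ≥ 2 d + 1` (`scaledCoeff_eq`, `norm_scaled_smooth_le`). At a point `z = ω x` the eliminant
is therefore a combination of the numbers obtained by applying `(x - E) ^ (d + 1)`, with `E` the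
unit shift, to the powers `t ^ (d - l)` at `t = k`. Put `x = 1 + s / k` and expand
`x - E = s / k - Δ` by the binomial theorem. Since `Δ ^ a` lowers the order of a power by `a`, the
`l`-th term is `O(k ^ (-l - 1))`, and `k` times the term `l = 0` tends to a polynomial in `s`
(`exists_altSum_sub_bound`). That polynomial is `(1 - D) ^ d s ^ (d + 1)`, which is
`s L_d^{(1)}(s)` up to a constant factor (`altSumLimit_eq_eval`, `X_mul_laguerre`).
Rolle's theorem applied to `e ^ (-x) P(x)` shows that each application of `1 - D` creates a new
simple positive root, so the limit polynomial has the simple roots `0 < φ_1 < … < φ_d`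
(`exists_roots_laguerre`).

The eliminant is thus `O(H k ^ (-2))` at each point `ω (1 + φ_i / k)`. At `ω` itself the terms
`l ≤ d` vanish exactly, because `Δ ^ (d + 1)` kills polynomials of degree at most `d`, and the
eliminant is `O(H k ^ (-d - 2))`. No analysis of the eliminant at other points is needed. Its leading
coefficient is at least `(J / 2) k ^ d`, so these values bound the products of the distances from
the points to the roots. The points are separated by a multiple of `1 / k`, hence each has exactly
one root nearby, and dividing by the `d` other distances gives the stated rates
(`norm_sub_mul_le_of_prod_le`). The norms of the points are separated by a multiple of `1 / k` as
well, so the matching respects the order of the norms, and `κ 0` is the root closest to the unit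
circle.
-/

noncomputable section

namespace FourierJump

/-! ### Fourier coefficients of a function with a single jump -/

lemma norm_jumpPoint (ξ : ℝ) : ‖jumpPoint ξ‖ = 1 := by
  rw [jumpPoint, show -(Complex.I * (ξ : ℂ)) = ((-ξ : ℝ) : ℂ) * Complex.I by push_cast; ring]
  exact Complex.norm_exp_ofReal_mul_I _

/-- A function on the circle that is continuous on one full open period and has one-sided limits
at the ends of that period is integrable. -/
lemma HasSingleJump.intervalIntegrable {f : ℝ → ℝ} {ξ : ℝ} {n : ℕ} {A : ℕ → ℝ}
    (h : HasSingleJump f ξ n A) (a b : ℝ) : IntervalIntegrable f MeasureTheory.volume a b := by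
  have hpi := Real.two_pi_pos
  refine h.periodic.intervalIntegrable hpi.ne' (t := ξ) ?_ a b
  obtain ⟨u, v, hu, hv, -⟩ := h.jump 0 (Nat.zero_le _)
  rw [iteratedDeriv_zero] at hu hv
  have hv' : Filter.Tendsto f (nhdsWithin (ξ + 2 * Real.pi) (Set.Iio (ξ + 2 * Real.pi)))
      (nhds v) := by
    have h1 : f = fun x => f (x - 2 * Real.pi) := by
      funext x; exact (h.periodic.sub_eq x).symm
    rw [h1]
    refine hv.comp (tendsto_nhdsWithin_iff.2 ⟨?_, ?_⟩)
    · have : Filter.Tendsto (fun x : ℝ => x - 2 * Real.pi) (nhds (ξ + 2 * Real.pi))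
          (nhds (ξ + 2 * Real.pi - 2 * Real.pi)) := by
        exact (continuous_id.sub continuous_const).tendsto _
      rw [add_sub_cancel_right] at this
      exact this.mono_left nhdsWithin_le_nhds
    · filter_upwards [self_mem_nhdsWithin] with x hx
      simp only [Set.mem_Iio] at hx ⊢
      linarith
  have hc := continuousOn_Icc_extendFrom_Ioo h.contDiffOn.continuousOn hu hv'
  have hle : ξ ≤ ξ + 2 * Real.pi := by linarith
  have hi := hc.intervalIntegrable_of_Icc (μ := MeasureTheory.volume) hle
  refine hi.congr_uIoo ?_
  intro x hx
  rw [Set.uIoo_of_le hle] at hx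
  exact extendFrom_extends h.contDiffOn.continuousOn x hx

lemma bernoulliSpline_periodic (l : ℕ) (ξ : ℝ) :
    Function.Periodic (bernoulliSpline l ξ) (2 * Real.pi) := by
  intro x
  have hpi := Real.two_pi_pos.ne'
  unfold bernoulliSpline
  rw [show (x + 2 * Real.pi - ξ) / (2 * Real.pi) = (x - ξ) / (2 * Real.pi) + 1 by
    field_simp; ring, Int.fract_add_one]

/-- On the period that starts at `ξ` the fractional part in `bernoulliSpline` can be dropped. -/
lemma bernoulliSpline_eq (l : ℕ) {ξ x : ℝ} (hx : x ∈ Set.Ico ξ (ξ + 2 * Real.pi)) :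
    bernoulliSpline l ξ x = -((2 * Real.pi) ^ l / ((l + 1).factorial : ℝ)) *
      bernoulliFun (l + 1) ((x - ξ) / (2 * Real.pi)) := by
  have hpi := Real.two_pi_pos
  unfold bernoulliSpline
  rw [Int.fract_eq_self.2]
  constructor
  · exact div_nonneg (by linarith [hx.1]) hpi.le
  · rw [div_lt_one hpi]; linarith [hx.2]

lemma continuous_bernoulliFun (n : ℕ) : Continuous (bernoulliFun n) := by
  unfold bernoulliFun
  exact Polynomial.continuous _

lemma intervalIntegrable_bernoulliSpline (l : ℕ) (ξ a b : ℝ) :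
    IntervalIntegrable (bernoulliSpline l ξ) MeasureTheory.volume a b := by
  have hpi := Real.two_pi_pos
  refine (bernoulliSpline_periodic l ξ).intervalIntegrable hpi.ne' (t := ξ) ?_ a b
  have hc : Continuous (fun x : ℝ => -((2 * Real.pi) ^ l / ((l + 1).factorial : ℝ)) *
      bernoulliFun (l + 1) ((x - ξ) / (2 * Real.pi))) :=
    continuous_const.mul ((continuous_bernoulliFun _).comp (by fun_prop))
  refine (hc.intervalIntegrable (μ := MeasureTheory.volume) ξ (ξ + 2 * Real.pi)).congr_uIoo ?_
  intro x hx
  rw [Set.uIoo_of_le (by linarith)] at hx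
  exact (bernoulliSpline_eq l ⟨hx.1.le, hx.2⟩).symm

lemma intervalIntegrable_mul_exp {f : ℝ → ℝ} {a b : ℝ}
    (hf : IntervalIntegrable f MeasureTheory.volume a b) (k : ℤ) :
    IntervalIntegrable (fun t : ℝ => (f t : ℂ) * Complex.exp (-(Complex.I * (k : ℂ) * (t : ℂ))))
      MeasureTheory.volume a b := by
  refine IntervalIntegrable.mul_continuousOn ?_ (Continuous.continuousOn (by fun_prop))
  exact ⟨hf.1.ofReal, hf.2.ofReal⟩

/-- The Bernoulli spline `V_l` has the Fourier coefficients of a unit jump in the `l`-th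
derivative. -/
lemma fourierCoefficient_bernoulliSpline (l : ℕ) (ξ : ℝ) {k : ℕ} (hk : k ≠ 0) :
    fourierCoefficient (bernoulliSpline l ξ) (k : ℤ)
      = jumpPoint ξ ^ k / (2 * (Real.pi : ℂ) * (Complex.I * (k : ℂ)) ^ (l + 1)) := by
  have hpi := Real.two_pi_pos
  have hpiC : (Real.pi : ℂ) ≠ 0 := by exact_mod_cast Real.pi_ne_zero
  have hkC : (k : ℂ) ≠ 0 := by exact_mod_cast hk
  have hfac : ((l + 1).factorial : ℂ) ≠ 0 := by exact_mod_cast (Nat.factorial_ne_zero _)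
  set F : ℝ → ℂ := fun t => (bernoulliSpline l ξ t : ℂ) *
    Complex.exp (-(Complex.I * ((k : ℤ) : ℂ) * (t : ℂ))) with hF
  have hper : Function.Periodic F (2 * Real.pi) := by
    intro t
    simp only [hF]
    rw [bernoulliSpline_periodic l ξ t]
    congr 1
    rw [Complex.exp_eq_exp_iff_exists_int]
    exact ⟨-k, by push_cast; ring⟩
  have h1 : ∫ t in (-Real.pi)..Real.pi, F t = ∫ t in ξ..(ξ + 2 * Real.pi), F t := by
    have := hper.intervalIntegral_add_eq (-Real.pi) ξ
    rwa [show -Real.pi + 2 * Real.pi = Real.pi by ring] at this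
  have hB := bernoulliFourierCoeff_eq (Nat.succ_ne_zero l) (k : ℤ)
  rw [bernoulliFourierCoeff, fourierCoeffOn_eq_integral] at hB
  set G : ℝ → ℂ := fun x => fourier (T := (1 : ℝ) - 0) (-(k : ℤ)) (x : AddCircle ((1 : ℝ) - 0)) •
    (bernoulliFun (l + 1) x : ℂ) with hG
  have h2 : ∫ t in ξ..(ξ + 2 * Real.pi), F t
      = ∫ t in ξ..(ξ + 2 * Real.pi), (-((2 * Real.pi) ^ l / ((l + 1).factorial : ℂ)) *
          jumpPoint ξ ^ k) * G ((t - ξ) / (2 * Real.pi)) := by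
    apply intervalIntegral.integral_congr_ae
    have hne : ∀ᵐ t : ℝ, t ≠ ξ + 2 * Real.pi := by
      simp [MeasureTheory.ae_iff, MeasureTheory.measure_singleton]
    filter_upwards [hne] with t ht htm
    rw [Set.uIoc_of_le (by linarith)] at htm
    simp only [hF, hG]
    rw [bernoulliSpline_eq l ⟨htm.1.le, lt_of_le_of_ne htm.2 ht⟩, jumpPoint, ← Complex.exp_nat_mul,
      fourier_coe_apply, smul_eq_mul]
    have : Complex.exp (-(Complex.I * ((k : ℤ) : ℂ) * (t : ℂ)))
        = Complex.exp ((k : ℂ) * -(Complex.I * (ξ : ℂ))) *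
          Complex.exp (2 * (Real.pi : ℂ) * Complex.I * ((-(k : ℤ) : ℤ) : ℂ) *
            (((t - ξ) / (2 * Real.pi) : ℝ) : ℂ) / ((1 - 0 : ℝ) : ℂ)) := by
      rw [← Complex.exp_add]
      congr 1
      push_cast
      field_simp
      ring
    rw [this]
    push_cast
    ring
  have h3 : ∫ t in ξ..(ξ + 2 * Real.pi), G ((t - ξ) / (2 * Real.pi))
      = (2 * Real.pi) • ∫ x in (0 : ℝ)..1, G x := by
    have e : ∀ t : ℝ, (t - ξ) / (2 * Real.pi) = t / (2 * Real.pi) - ξ / (2 * Real.pi) := by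
      intro t; ring
    simp only [e]
    rw [intervalIntegral.integral_comp_div_sub G hpi.ne' (ξ / (2 * Real.pi)), ← e, ← e]
    simp [Real.pi_ne_zero]
  have hG1 : ∫ x in (0 : ℝ)..1, G x
      = -((l + 1).factorial : ℂ) / (2 * Real.pi * Complex.I * (k : ℂ)) ^ (l + 1) := by
    simpa [hG] using hB
  have hI := Complex.I_ne_zero
  rw [fourierCoefficient]
  change 1 / (2 * (Real.pi : ℂ)) * ∫ t in (-Real.pi)..Real.pi, F t = _
  rw [h1, h2, intervalIntegral.integral_const_mul, h3, hG1, Complex.real_smul]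
  push_cast
  simp only [mul_pow, pow_succ]
  field_simp

/-- The Fourier coefficients of `f` split into the contributions of the jumps and those of the
smooth component. -/
lemma fourierCoefficient_eq_sum_add {f : ℝ → ℝ} {ξ : ℝ} {n : ℕ} {A : ℕ → ℝ}
    (h : HasSingleJump f ξ n A) {k : ℕ} (hk : k ≠ 0) :
    fourierCoefficient f (k : ℤ)
      = ∑ l ∈ Finset.range (n + 1), (A l : ℂ) *
          (jumpPoint ξ ^ k / (2 * (Real.pi : ℂ) * (Complex.I * (k : ℂ)) ^ (l + 1)))
        + fourierCoefficient (smoothPart f n ξ A) (k : ℤ) := by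
  have hV : ∀ l, IntervalIntegrable (fun t : ℝ => (A l : ℂ) * ((bernoulliSpline l ξ t : ℂ) *
      Complex.exp (-(Complex.I * ((k : ℤ) : ℂ) * (t : ℂ))))) MeasureTheory.volume
      (-Real.pi) Real.pi := fun l =>
    (intervalIntegrable_mul_exp (intervalIntegrable_bernoulliSpline l ξ _ _) _).const_mul _
  have hsum : ∀ t : ℝ, ((smoothPart f n ξ A t : ℝ) : ℂ) *
      Complex.exp (-(Complex.I * ((k : ℤ) : ℂ) * (t : ℂ)))
      = (f t : ℂ) * Complex.exp (-(Complex.I * ((k : ℤ) : ℂ) * (t : ℂ)))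
        - ∑ l ∈ Finset.range (n + 1), (A l : ℂ) * ((bernoulliSpline l ξ t : ℂ) *
            Complex.exp (-(Complex.I * ((k : ℤ) : ℂ) * (t : ℂ)))) := by
    intro t
    rw [smoothPart, singularPart]
    push_cast
    rw [sub_mul, Finset.sum_mul]
    simp only [mul_assoc]
  have hsm : fourierCoefficient (smoothPart f n ξ A) (k : ℤ)
      = fourierCoefficient f (k : ℤ)
        - ∑ l ∈ Finset.range (n + 1), (A l : ℂ) *
          fourierCoefficient (bernoulliSpline l ξ) (k : ℤ) := by
    unfold fourierCoefficient
    simp only [hsum]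
    rw [intervalIntegral.integral_sub (intervalIntegrable_mul_exp (h.intervalIntegrable _ _) _)
        (by
          have := IntervalIntegrable.sum (Finset.range (n + 1)) (fun l _ => hV l)
          simpa [Finset.sum_fn] using this),
      intervalIntegral.integral_finsetSum (fun l _ => hV l), mul_sub, Finset.mul_sum]
    simp only [intervalIntegral.integral_const_mul]
    congr 1
    refine Finset.sum_congr rfl fun l _ => ?_
    ring
  rw [hsm]
  simp only [fourierCoefficient_bernoulliSpline _ ξ hk]
  ring

/-! ### Zeros of Laguerre polynomials -/

/-- Rolle's theorem on a half-line: a differentiable function that vanishes at `a` and tends to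
zero at infinity has a critical point beyond `a`. -/
lemma exists_deriv_eq_zero_of_tendsto_zero {h : ℝ → ℝ} {a : ℝ} (hd : Differentiable ℝ h)
    (ha : h a = 0) (hlim : Filter.Tendsto h Filter.atTop (nhds 0)) :
    ∃ x, a < x ∧ deriv h x = 0 := by
  by_cases h0 : h (a + 1) = 0
  · obtain ⟨x, hx, hx'⟩ := exists_deriv_eq_zero (lt_add_one a) hd.continuous.continuousOn
      (ha.trans h0.symm)
    exact ⟨x, hx.1, hx'⟩
  -- Half the value at `a + 1` is taken on both sides of `a + 1`.
  set v := h (a + 1) with hv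
  have hev : ∀ᶠ x in Filter.atTop, |h x| < |v| / 2 := by
    have := hlim.abs
    rw [abs_zero] at this
    exact this.eventually (gt_mem_nhds (by positivity))
  obtain ⟨b, hb, hba⟩ := (hev.and (Filter.eventually_gt_atTop (a + 1))).exists
  have hb' := abs_lt.1 hb
  have hmid : v / 2 ∈ Set.uIcc (h a) (h (a + 1)) ∧ v / 2 ∈ Set.uIcc (h b) (h (a + 1)) := by
    rw [ha, ← hv]
    rcases lt_or_gt_of_ne h0 with hneg | hpos
    · rw [abs_of_neg hneg] at hb'
      constructor <;> rw [Set.mem_uIcc]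
      · right; constructor <;> linarith
      · right; constructor <;> linarith [hb'.1]
    · rw [abs_of_pos hpos] at hb'
      constructor <;> rw [Set.mem_uIcc]
      · left; constructor <;> linarith
      · left; constructor <;> linarith [hb'.2]
  obtain ⟨x, hx, hxv⟩ := intermediate_value_uIcc hd.continuous.continuousOn hmid.1
  obtain ⟨y, hy, hyv⟩ := intermediate_value_uIcc hd.continuous.continuousOn hmid.2
  rw [Set.uIcc_of_le (by linarith)] at hx
  rw [Set.uIcc_comm, Set.uIcc_of_le hba.le] at hy
  have hxa : x ≠ a := by
    rintro rfl
    exact h0 (by linarith)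
  have hxa' : a < x := lt_of_le_of_ne hx.1 hxa.symm
  have hxy : x < y := by
    have hx1 : x ≠ a + 1 := by
      rintro rfl
      exact h0 (by linarith)
    exact lt_of_lt_of_le (lt_of_le_of_ne hx.2 hx1) hy.1
  obtain ⟨z, hz, hz'⟩ := exists_deriv_eq_zero hxy hd.continuous.continuousOn (hxv.trans hyv.symm)
  exact ⟨z, hxa'.trans hz.1, hz'⟩

open Polynomial in
/-- If `P` is monic with simple positive roots, so is `(X - c) P - X P'` for `c ≥ 1`. -/
lemma exists_roots_laguerreStep {n : ℕ} (φ : Fin n → ℝ) (hφ : StrictMono φ) (hpos : ∀ i, 0 < φ i)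
    (c : ℕ) :
    ∃ ψ : Fin (n + 1) → ℝ, StrictMono ψ ∧ (∀ i, 0 < ψ i) ∧
      (X - C ((c : ℝ) + 1)) * (∏ i, (X - C (φ i))) - X * derivative (∏ i, (X - C (φ i)))
        = ∏ i, (X - C (ψ i)) := by
  set P : ℝ[X] := ∏ i, (X - C (φ i)) with hP
  set Q : ℝ[X] := (X - C ((c : ℝ) + 1)) * P - X * derivative P with hQ
  have hPm : P.Monic := monic_prod_X_sub_C _ _
  have hPd : P.natDegree = n := by simp [hP]
  have hPφ : ∀ i, P.eval (φ i) = 0 := by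
    intro i
    rw [hP, eval_prod]
    exact Finset.prod_eq_zero (Finset.mem_univ i) (by simp)
  -- `Q` is, up to a positive factor, minus the derivative of this function.
  set h : ℝ → ℝ := fun x => (X ^ (c + 1) * P).eval x * Real.exp (-x) with hh
  have hder : ∀ x, HasDerivAt h (-(x ^ c * Q.eval x * Real.exp (-x))) x := by
    intro x
    have h1 := (X ^ (c + 1) * P).hasDerivAt x
    have h2 : HasDerivAt (fun x : ℝ => Real.exp (-x)) (-Real.exp (-x)) x := by
      simpa using (hasDerivAt_neg x).exp
    refine (h1.mul h2).congr_deriv ?_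
    simp only [hQ, derivative_mul, derivative_X_pow, eval_add, eval_mul, eval_pow, eval_X,
      eval_sub, eval_C, Nat.add_sub_cancel]
    push_cast
    ring
  have hdiff : Differentiable ℝ h := fun x => (hder x).differentiableAt
  have hlim : Filter.Tendsto h Filter.atTop (nhds 0) := by
    have := Polynomial.tendsto_div_exp_atTop (X ^ (c + 1) * P)
    refine this.congr fun x => ?_
    simp only [hh, Real.exp_neg, div_eq_mul_inv]
  -- The zeros of `h` used: the origin and the roots of `P`.
  set t : Fin (n + 1) → ℝ := Fin.cons 0 φ with ht
  have ht0 : ∀ i, 0 ≤ t i := by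
    intro i
    refine Fin.cases ?_ (fun i => ?_) i
    · simp [ht]
    · simpa [ht] using (hpos i).le
  have hht : ∀ i, h (t i) = 0 := by
    intro i
    refine Fin.cases ?_ (fun i => ?_) i
    · simp [ht, hh]
    · simp [ht, hh, hPφ i]
  have htm : StrictMono t := Fin.strictMono_cons.2 ⟨hpos, hφ⟩
  have key : ∀ i : Fin (n + 1), ∃ x, t i < x ∧ (∀ j, i < j → x < t j) ∧ Q.eval x = 0 := by
    intro i
    have aux : ∀ x, t i < x → deriv h x = 0 → Q.eval x = 0 := by
      intro x hx hx'
      rw [(hder x).deriv] at hx'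
      have hx0 : x ≠ 0 := (lt_of_le_of_lt (ht0 i) hx).ne'
      simpa [hx0, Real.exp_ne_zero] using hx'
    by_cases hi : (i : ℕ) + 1 < n + 1
    · have hlt : t i < t ⟨i + 1, hi⟩ := htm (by simp [Fin.lt_def])
      obtain ⟨x, hx, hx'⟩ := exists_deriv_eq_zero hlt hdiff.continuous.continuousOn
        ((hht _).trans (hht _).symm)
      refine ⟨x, hx.1, fun j hj => lt_of_lt_of_le hx.2 (htm.monotone ?_), aux x hx.1 hx'⟩
      rw [Fin.le_def]; exact hj
    · obtain ⟨x, hx, hx'⟩ := exists_deriv_eq_zero_of_tendsto_zero hdiff (hht i) hlim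
      refine ⟨x, hx, fun j hj => ?_, aux x hx hx'⟩
      have := j.2
      rw [Fin.lt_def] at hj
      omega
  choose ψ hψ1 hψ2 hψ3 using key
  have hψm : StrictMono ψ := fun i j hij => (hψ2 i j hij).trans (hψ1 j)
  refine ⟨ψ, hψm, fun i => lt_of_le_of_lt (ht0 i) (hψ1 i), ?_⟩
  -- Both sides are monic of degree `n + 1` and share `n + 1` distinct roots.
  have hXP : ((X - C ((c : ℝ) + 1)) * P).Monic := (monic_X_sub_C _).mul hPm
  have hXPd : ((X - C ((c : ℝ) + 1)) * P).natDegree = n + 1 := by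
    rw [(monic_X_sub_C _).natDegree_mul hPm, natDegree_X_sub_C, hPd, add_comm]
  have hlow : (X * derivative P).degree < ((X - C ((c : ℝ) + 1)) * P).degree := by
    rw [degree_eq_natDegree hXP.ne_zero, hXPd]
    rcases Nat.eq_zero_or_pos n with hn | hn
    · have : P = 1 := by
        subst hn; simp [hP]
      simp only [this, derivative_one, mul_zero, degree_zero]
      exact WithBot.bot_lt_coe _
    · refine lt_of_le_of_lt degree_le_natDegree ?_
      have h1 : (derivative P).natDegree < n := by
        rw [← hPd]; exact natDegree_derivative_lt (by omega)
      have h2 := natDegree_mul_le (p := X) (q := derivative P)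
      rw [natDegree_X] at h2
      exact_mod_cast (by omega : (X * derivative P).natDegree < n + 1)
  have hQm : Q.Monic := hXP.sub_of_left hlow
  have hQd : Q.natDegree = n + 1 := by
    rw [hQ, natDegree_sub_eq_left_of_natDegree_lt, hXPd]
    rcases eq_or_ne (X * derivative P) 0 with h0 | h0
    · rw [h0, hXPd]; simp
    · exact (natDegree_lt_natDegree_iff h0).2 hlow
  have hdvd : (∏ i, (X - C (ψ i))) ∣ Q := by
    refine Finset.prod_dvd_of_coprime ?_ (fun i _ => dvd_iff_isRoot.2 (hψ3 i))
    exact fun i _ j _ hij => pairwise_coprime_X_sub_C hψm.injective hij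
  exact (eq_of_monic_of_dvd_of_natDegree_le (monic_prod_X_sub_C _ _) hQm hdvd
    (by rw [hQd]; simp)).symm ▸ rfl

open Polynomial in
/-- The polynomials `(1 - D)^j X^n`, `j ≤ n`, have only the root `0` and `j` simple positive
roots. -/
lemma exists_roots_one_sub_derivative_pow (n j : ℕ) (hj : j ≤ n) :
    ∃ φ : Fin j → ℝ, StrictMono φ ∧ (∀ i, 0 < φ i) ∧
      ((1 - derivative : ℝ[X] →ₗ[ℝ] ℝ[X]) ^ j) (X ^ n) = X ^ (n - j) * ∏ i, (X - C (φ i)) := by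
  induction j with
  | zero => exact ⟨Fin.elim0, fun i => i.elim0, fun i => i.elim0, by simp⟩
  | succ j ih =>
    obtain ⟨φ, h1, h2, h3⟩ := ih (by omega)
    obtain ⟨c, hc⟩ : ∃ c, n - j = c + 1 := ⟨n - j - 1, by omega⟩
    obtain ⟨ψ, g1, g2, g3⟩ := exists_roots_laguerreStep φ h1 h2 c
    refine ⟨ψ, g1, g2, ?_⟩
    rw [pow_succ', Module.End.mul_apply, h3, hc, show n - (j + 1) = c by omega, ← g3]
    simp only [LinearMap.sub_apply, Module.End.one_apply, derivative_mul, derivative_X_pow,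
      Nat.add_sub_cancel, Nat.cast_add, Nat.cast_one, map_add, map_natCast, map_one]
    ring

open Polynomial in
/-- `(1 - D)^d X^(d+1)`, written out. -/
lemma one_sub_derivative_pow_X_pow (d : ℕ) :
    ((1 - derivative : ℝ[X] →ₗ[ℝ] ℝ[X]) ^ d) (X ^ (d + 1))
      = ∑ m ∈ Finset.range (d + 1),
          C ((-1 : ℝ) ^ m * (d.choose m : ℝ) * ((d + 1).descFactorial m : ℝ)) * X ^ (d + 1 - m) := by
  have hcomm : Commute ((-1 : ℝ) • (derivative : Module.End ℝ ℝ[X])) 1 := Commute.one_right _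
  have h : (1 - derivative : Module.End ℝ ℝ[X]) = (-1 : ℝ) • derivative + 1 := by
    refine LinearMap.ext fun p => ?_
    rw [LinearMap.sub_apply, LinearMap.add_apply, LinearMap.smul_apply, neg_one_smul]
    exact sub_eq_neg_add _ _
  refine (congrArg (fun T : Module.End ℝ ℝ[X] => (T ^ d) (X ^ (d + 1))) h).trans ?_
  simp only [hcomm.add_pow, LinearMap.sum_apply]
  refine Finset.sum_congr rfl fun m _ => ?_
  rw [one_pow, mul_one, ← nsmul_eq_mul', LinearMap.smul_apply, _root_.smul_pow, LinearMap.smul_apply,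
    Module.End.pow_apply, iterate_derivative_X_pow_eq_natCast_mul, nsmul_eq_mul, smul_eq_C_mul]
  simp only [map_mul, map_natCast, map_pow, map_neg, map_one]
  ring

open Polynomial in
lemma X_mul_laguerre (d : ℕ) :
    X * (C ((-1 : ℝ) ^ d * (d.factorial : ℝ)) * laguerre 1 d)
      = ((1 - derivative : ℝ[X] →ₗ[ℝ] ℝ[X]) ^ d) (X ^ (d + 1)) := by
  rw [one_sub_derivative_pow_X_pow, laguerre, Finset.mul_sum, Finset.mul_sum,
    ← Finset.sum_range_reflect]
  refine Finset.sum_congr rfl fun m hm => ?_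
  have hm' : m ≤ d := Nat.lt_succ_iff.1 (Finset.mem_range.1 hm)
  obtain ⟨e, rfl⟩ := Nat.exists_eq_add_of_le hm'
  rw [show m + e + 1 - 1 - m = e by omega, show m + e - e = m by omega,
    show m + e + 1 - m = e + 1 by omega, ← C_mul_X_pow_eq_monomial, pow_succ' X e]
  have hf : ((m + e).factorial : ℝ) * ((m + e + 1).choose m : ℝ) / (e.factorial : ℝ)
      = ((m + e).choose m : ℝ) * ((m + e + 1).descFactorial m : ℝ) := by
    have h1 : ((m + e).choose m * m.factorial * e.factorial : ℝ) = (m + e).factorial := by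
      have := Nat.choose_mul_factorial_mul_factorial (Nat.le_add_right m e)
      rw [Nat.add_sub_cancel_left] at this
      exact_mod_cast this
    rw [Nat.descFactorial_eq_factorial_mul_choose]
    have : (e.factorial : ℝ) ≠ 0 := by positivity
    push_cast
    rw [← h1]
    field_simp
  have hs : ((-1 : ℝ) ^ (m + e) * (-1) ^ e) = (-1) ^ m := by
    rw [pow_add, mul_assoc, ← mul_pow]; simp
  rw [mul_assoc ((-1 : ℝ) ^ m), ← hf, ← hs]
  simp only [← mul_assoc, ← X_mul_C]
  rw [mul_assoc X, ← C_mul]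
  rw [X_mul_C, X_mul_C]
  congr 3
  ring

open Polynomial in
/-- The roots of the Laguerre polynomial `L_d^{(1)}` are positive and simple. -/
lemma exists_roots_laguerre (d : ℕ) :
    ∃ φ : Fin d → ℝ, StrictMono φ ∧ (∀ i, 0 < φ i) ∧
      (laguerre 1 d).roots = Multiset.map φ Finset.univ.val ∧
      ∀ i, (((1 - derivative : ℝ[X] →ₗ[ℝ] ℝ[X]) ^ d) (X ^ (d + 1))).eval (φ i) = 0 := by
  obtain ⟨φ, h1, h2, h3⟩ := exists_roots_one_sub_derivative_pow (d + 1) d (Nat.le_succ d)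
  refine ⟨φ, h1, h2, ?_, fun i => ?_⟩
  · have h4 := X_mul_laguerre d
    rw [h3, Nat.add_sub_cancel_left, pow_one] at h4
    have h5 := mul_left_cancel₀ X_ne_zero h4
    rw [← roots_C_mul (laguerre 1 d) (a := (-1 : ℝ) ^ d * (d.factorial : ℝ))
      (mul_ne_zero (by simp) (by positivity)), h5]
    exact roots_multiset_prod_X_sub_C (Multiset.map φ Finset.univ.val) ▸ by
      rw [Finset.prod_eq_multiset_prod, Multiset.map_map]; rfl
  · rw [h3, eval_mul, eval_prod, Finset.prod_eq_zero (Finset.mem_univ i) (by simp), mul_zero]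

/-! ### Weighted alternating sums of powers -/

/-- Taylor's formula for `y ↦ (1 + y) ^ p`, `p` an integer, with a uniform remainder. -/
lemma exists_binomial_remainder_bound (p : ℤ) (n : ℕ) {b : ℝ} (hb : 0 < b) :
    ∃ C : ℝ, 0 ≤ C ∧ ∀ y ∈ Set.Icc 0 b,
      |(1 + y) ^ p - ∑ m ∈ Finset.range (n + 1),
        ((m.factorial : ℝ)⁻¹ * ∏ i ∈ Finset.range m, ((p : ℝ) - i)) * y ^ m| ≤ C * y ^ (n + 1) := by
  have hcd : ∀ x : ℝ, 0 < x → ∀ N : WithTop ℕ∞, ContDiffAt ℝ N (fun x : ℝ => x ^ p) x :=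
    fun x hx N => ((analyticAt_id (𝕜 := ℝ) (z := x)).zpow (n := p) hx.ne').contDiffAt
  have hon : ContDiffOn ℝ (n + 1) (fun x : ℝ => x ^ p) (Set.Icc 1 (1 + b)) := fun x hx =>
    (hcd x (by linarith [hx.1]) _).contDiffWithinAt
  obtain ⟨C, hC⟩ := exists_taylor_mean_remainder_bound (by linarith : (1 : ℝ) ≤ 1 + b) hon
  refine ⟨max C 0, le_max_right _ _, fun y hy => ?_⟩
  have h := hC (1 + y) ⟨by linarith [hy.1], by linarith [hy.2]⟩
  rw [taylor_within_apply, Real.norm_eq_abs] at h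
  have hcoef : ∀ m : ℕ, iteratedDerivWithin m (fun x : ℝ => x ^ p) (Set.Icc 1 (1 + b)) 1
      = ∏ i ∈ Finset.range m, ((p : ℝ) - i) := by
    intro m
    rw [iteratedDerivWithin_eq_iteratedDeriv (uniqueDiffOn_Icc (by linarith))
      (hcd 1 one_pos _) ⟨le_refl _, by linarith⟩, iteratedDeriv_eq_iterate, iter_deriv_zpow]
    simp
  simp only [hcoef, add_sub_cancel_left, smul_eq_mul] at h
  have e : ∀ m ∈ Finset.range (n + 1), ((m.factorial : ℝ)⁻¹ * ∏ i ∈ Finset.range m, ((p : ℝ) - i))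
      * y ^ m = (m.factorial : ℝ)⁻¹ * y ^ m * ∏ i ∈ Finset.range m, ((p : ℝ) - i) := by
    intro m _; ring
  rw [Finset.sum_congr rfl e]
  exact h.trans (mul_le_mul_of_nonneg_right (le_max_left _ _) (pow_nonneg hy.1 _))

/-- Asymptotics of the `a`-th difference of `t ↦ (1 + t h) ^ p` as `h → 0`. -/
lemma exists_fwdDiff_zpow_bound (p : ℤ) (a : ℕ) :
    ∃ C : ℝ, 0 ≤ C ∧ ∀ h ∈ Set.Icc (0 : ℝ) 1,
      |(fwdDiff (1 : ℝ))^[a] (fun t => (1 + t * h) ^ p) 0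
        - (∏ i ∈ Finset.range a, ((p : ℝ) - i)) * h ^ a| ≤ C * h ^ (a + 1) := by
  obtain ⟨C, hC0, hC⟩ := exists_binomial_remainder_bound p a (b := (a : ℝ) + 1) (by positivity)
  set c : ℕ → ℝ := fun m => (m.factorial : ℝ)⁻¹ * ∏ i ∈ Finset.range m, ((p : ℝ) - i) with hc
  refine ⟨∑ j ∈ Finset.range (a + 1), (a.choose j : ℝ) * (C * (j : ℝ) ^ (a + 1)),
    by positivity, fun h hh => ?_⟩
  set P : ℝ → ℝ := fun t => ∑ m ∈ Finset.range (a + 1), (c m * h ^ m) * t ^ m with hP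
  have hPd : (fwdDiff (1 : ℝ))^[a] P 0 = (∏ i ∈ Finset.range a, ((p : ℝ) - i)) * h ^ a := by
    have hPe : P = ∑ m ∈ Finset.range (a + 1), (c m * h ^ m) • (fun t : ℝ => t ^ m) := by
      funext t
      simp [hP]
    rw [hPe, fwdDiff_iter_finsetSum, Finset.sum_range_succ, Finset.sum_eq_zero, zero_add,
      fwdDiff_iter_const_smul, fwdDiff_iter_eq_factorial]
    · simp only [hc, Pi.smul_apply, Pi.natCast_apply, smul_eq_mul]
      have : (a.factorial : ℝ) ≠ 0 := by positivity
      field_simp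
    · intro m hm
      rw [fwdDiff_iter_const_smul, fwdDiff_iter_pow_eq_zero_of_lt (Finset.mem_range.1 hm),
        smul_zero]
  rw [← hPd, fwdDiff_iter_eq_sum_shift, fwdDiff_iter_eq_sum_shift, ← Finset.sum_sub_distrib,
    Finset.sum_mul]
  refine (Finset.abs_sum_le_sum_abs _ _).trans (Finset.sum_le_sum fun j hj => ?_)
  have hj' : (j : ℝ) ≤ a := by exact_mod_cast Nat.lt_succ_iff.1 (Finset.mem_range.1 hj)
  rw [← smul_sub, zsmul_eq_mul, abs_mul, mul_assoc]
  have h1 : |((((-1 : ℤ) ^ (a - j) * (a.choose j : ℤ) : ℤ)) : ℝ)| = (a.choose j : ℝ) := by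
    push_cast
    rw [abs_mul, abs_pow, abs_neg, abs_one, one_pow, one_mul, Nat.abs_cast]
  rw [h1]
  refine mul_le_mul_of_nonneg_left ?_ (Nat.cast_nonneg _)
  have h2 := hC ((j : ℝ) * h) ⟨mul_nonneg (Nat.cast_nonneg _) hh.1, by nlinarith [hh.1, hh.2]⟩
  simp only [zero_add, nsmul_eq_mul, mul_one, hP]
  rw [mul_assoc, ← mul_pow]
  have h3 : ∑ m ∈ Finset.range (a + 1), c m * h ^ m * (j : ℝ) ^ m
      = ∑ m ∈ Finset.range (a + 1), c m * ((j : ℝ) * h) ^ m :=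
    Finset.sum_congr rfl fun m _ => by rw [mul_pow]; ring
  rw [h3]
  exact h2

/-- The `N`-th power of `x - E`, `E` the unit shift, expanded in powers of `E` and of `E - 1`. -/
lemma sum_shift_eq_sum_fwdDiff (G : ℝ → ℝ) (x : ℝ) (N : ℕ) :
    ∑ j ∈ Finset.range (N + 1), (-1 : ℝ) ^ j * (N.choose j : ℝ) * G j * x ^ (N - j)
      = ∑ a ∈ Finset.range (N + 1),
          (N.choose a : ℝ) * (x - 1) ^ (N - a) * (-1) ^ a * (fwdDiff (1 : ℝ))^[a] G 0 := by
  let E : Module.End ℝ (ℝ → ℝ) := LinearMap.funLeft ℝ ℝ (fun t : ℝ => t + 1)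
  have hE : ∀ (j : ℕ) (F : ℝ → ℝ) (t : ℝ), (E ^ j) F t = F (t + j) := by
    intro j
    induction j with
    | zero => intro F t; simp
    | succ j ih =>
      intro F t
      rw [pow_succ, Module.End.mul_apply, ih]
      change F (t + j + 1) = _
      push_cast
      rw [add_assoc]
  have hD : ∀ (a : ℕ) (F : ℝ → ℝ), ((E - 1) ^ a) F = (fwdDiff (1 : ℝ))^[a] F := by
    intro a F
    rw [Module.End.pow_apply]
    congr 1
  have hexp : ∀ (S : Module.End ℝ (ℝ → ℝ)) (c : ℝ), ((c • (1 : Module.End ℝ (ℝ → ℝ)) - S) ^ N) G 0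
      = ∑ j ∈ Finset.range (N + 1), (N.choose j : ℝ) * c ^ (N - j) * (-1) ^ j * (S ^ j) G 0 := by
    intro S c
    have hcm : Commute ((-1 : ℝ) • S) (c • (1 : Module.End ℝ (ℝ → ℝ))) :=
      ((Commute.one_right S).smul_left _).smul_right _
    have hS : c • (1 : Module.End ℝ (ℝ → ℝ)) - S = (-1 : ℝ) • S + c • 1 := by
      refine LinearMap.ext fun F => ?_
      simp only [LinearMap.sub_apply, LinearMap.add_apply, LinearMap.smul_apply, neg_one_smul]
      exact sub_eq_neg_add _ _
    rw [hS, hcm.add_pow, LinearMap.sum_apply, Finset.sum_apply]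
    refine Finset.sum_congr rfl fun j _ => ?_
    rw [smul_pow, smul_pow, one_pow, ← nsmul_eq_mul']
    simp only [LinearMap.smul_apply, Module.End.mul_apply, Module.End.one_apply, Pi.smul_apply,
      smul_eq_mul, map_smul, nsmul_eq_mul, Module.End.natCast_apply, Pi.mul_apply, Pi.natCast_apply]
    ring
  have h1 := hexp E x
  have h2 := hexp (E - 1) (x - 1)
  have hx : (x - 1) • (1 : Module.End ℝ (ℝ → ℝ)) - (E - 1) = x • 1 - E := by
    refine LinearMap.ext fun F => ?_
    simp only [LinearMap.sub_apply, LinearMap.smul_apply, Module.End.one_apply, sub_smul, one_smul]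
    abel
  rw [hx] at h2
  simp only [hD] at h2
  rw [← h2, h1]
  refine Finset.sum_congr rfl fun j _ => ?_
  rw [hE, zero_add]
  ring

/-- The limit, after rescaling by `h ^ N`, of the alternating sum in
`exists_altSum_scaled_bound`. -/
def altSumLimit (p : ℤ) (N : ℕ) (s : ℝ) : ℝ :=
  ∑ a ∈ Finset.range (N + 1),
    (N.choose a : ℝ) * s ^ (N - a) * (-1) ^ a * ∏ i ∈ Finset.range a, ((p : ℝ) - i)

/-- With `h = 1 / k`: the alternating sum vanishes to order `N` at `h = 0`, because the difference
of order `a` is `O(h ^ a)` and comes with the factor `(s h) ^ (N - a)`. -/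
lemma exists_altSum_scaled_bound (p : ℤ) (N : ℕ) (s : ℝ) :
    ∃ C : ℝ, 0 ≤ C ∧ ∀ h ∈ Set.Icc (0 : ℝ) 1,
      |∑ j ∈ Finset.range (N + 1), (-1 : ℝ) ^ j * (N.choose j : ℝ) * (1 + j * h) ^ p *
        (1 + s * h) ^ (N - j) - altSumLimit p N s * h ^ N| ≤ C * h ^ (N + 1) := by
  choose C hC0 hC using exists_fwdDiff_zpow_bound p
  refine ⟨∑ a ∈ Finset.range (N + 1), (N.choose a : ℝ) * |s| ^ (N - a) * C a,
    Finset.sum_nonneg fun a _ => mul_nonneg (by positivity) (hC0 a), fun h hh => ?_⟩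
  rw [sum_shift_eq_sum_fwdDiff (fun t => (1 + t * h) ^ p), altSumLimit, Finset.sum_mul,
    ← Finset.sum_sub_distrib, Finset.sum_mul]
  refine (Finset.abs_sum_le_sum_abs _ _).trans (Finset.sum_le_sum fun a ha => ?_)
  obtain ⟨e, rfl⟩ := Nat.exists_eq_add_of_le (Nat.lt_succ_iff.1 (Finset.mem_range.1 ha))
  rw [Nat.add_sub_cancel_left, add_sub_cancel_left]
  have h1 := hC a h hh
  calc _ = ((a + e).choose a : ℝ) * |s| ^ e * h ^ e *
        |(fwdDiff (1 : ℝ))^[a] (fun t => (1 + t * h) ^ p) 0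
          - (∏ i ∈ Finset.range a, ((p : ℝ) - i)) * h ^ a| := by
        rw [show ((a + e).choose a : ℝ) * (s * h) ^ e * (-1) ^ a *
            (fwdDiff (1 : ℝ))^[a] (fun t => (1 + t * h) ^ p) 0
            - ((a + e).choose a : ℝ) * s ^ e * (-1) ^ a *
              (∏ i ∈ Finset.range a, ((p : ℝ) - i)) * h ^ (a + e)
            = ((a + e).choose a : ℝ) * s ^ e * h ^ e * (-1) ^ a *
              ((fwdDiff (1 : ℝ))^[a] (fun t => (1 + t * h) ^ p) 0
              - (∏ i ∈ Finset.range a, ((p : ℝ) - i)) * h ^ a) by ring]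
        simp only [abs_mul, abs_pow, abs_neg, abs_one, one_pow, mul_one, Nat.abs_cast,
          abs_of_nonneg hh.1]
    _ ≤ ((a + e).choose a : ℝ) * |s| ^ e * h ^ e * (C a * h ^ (a + 1)) :=
        mul_le_mul_of_nonneg_left h1 (mul_nonneg (by positivity) (pow_nonneg hh.1 _))
    _ = _ := by ring

/-- The contribution of the term `k ^ p` of the scaled coefficients to the eliminant at the point
`ω (1 + s / k)`. -/
def altSum (d : ℕ) (p : ℤ) (k : ℕ) (s : ℝ) : ℝ :=
  ∑ j ∈ Finset.range (d + 2), (-1 : ℝ) ^ j * ((d + 1).choose j : ℝ) * ((k : ℝ) + j) ^ p *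
    (1 + s / k) ^ (d + 1 - j)

lemma exists_altSum_sub_bound (d l : ℕ) (s : ℝ) :
    ∃ C : ℝ, 0 ≤ C ∧ ∀ k : ℕ, 1 ≤ k →
      |altSum d ((d : ℤ) - l) k s - altSumLimit ((d : ℤ) - l) (d + 1) s / (k : ℝ) ^ (l + 1)|
        ≤ C / (k : ℝ) ^ (l + 2) := by
  obtain ⟨C, hC0, hC⟩ := exists_altSum_scaled_bound ((d : ℤ) - l) (d + 1) s
  refine ⟨C, hC0, fun k hk => ?_⟩
  have hk0 : (0 : ℝ) < k := by exact_mod_cast hk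
  have h1 := hC (1 / k) ⟨by positivity, by rw [div_le_one hk0]; exact_mod_cast hk⟩
  have h2 := mul_le_mul_of_nonneg_left h1 (zpow_pos hk0 ((d : ℤ) - l)).le
  have hz : ∀ m : ℕ, (k : ℝ) ^ ((d : ℤ) - l) * (1 / k) ^ (d + 1 + m)
      = 1 / (k : ℝ) ^ (l + 1 + m) := by
    intro m
    rw [zpow_sub₀ hk0.ne', zpow_natCast, zpow_natCast, one_div, inv_pow]
    field_simp
    ring
  have ha : altSum d ((d : ℤ) - l) k s = (k : ℝ) ^ ((d : ℤ) - l) *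
      ∑ j ∈ Finset.range (d + 1 + 1), (-1 : ℝ) ^ j * ((d + 1).choose j : ℝ) *
        (1 + j * (1 / k)) ^ ((d : ℤ) - l) * (1 + s * (1 / k)) ^ (d + 1 - j) := by
    rw [altSum, Finset.mul_sum]
    refine Finset.sum_congr rfl fun j _ => ?_
    rw [show (k : ℝ) + j = k * (1 + j * (1 / k)) by field_simp, mul_zpow, mul_one_div s]
    ring
  rw [← abs_of_pos (zpow_pos hk0 ((d : ℤ) - l)), ← abs_mul, abs_of_pos (zpow_pos hk0 _), mul_sub,
    ← ha] at h2
  have e1 := hz 0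
  have e2 := hz 1
  rw [add_zero, add_zero] at e1
  rw [mul_left_comm, e1, mul_left_comm, e2, mul_one_div, mul_one_div] at h2
  exact h2

lemma exists_altSum_bound (d l : ℕ) (s : ℝ) :
    ∃ C : ℝ, 0 ≤ C ∧ ∀ k : ℕ, 1 ≤ k →
      |altSum d ((d : ℤ) - l) k s| ≤ C / (k : ℝ) ^ (l + 1) := by
  obtain ⟨C, hC0, hC⟩ := exists_altSum_sub_bound d l s
  refine ⟨C + |altSumLimit ((d : ℤ) - l) (d + 1) s|, by positivity, fun k hk => ?_⟩
  have hk1 : (1 : ℝ) ≤ k := by exact_mod_cast hk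
  have h1 := hC k hk
  have h2 : C / (k : ℝ) ^ (l + 2) ≤ C / (k : ℝ) ^ (l + 1) :=
    div_le_div_of_nonneg_left hC0 (by positivity) (pow_le_pow_right₀ hk1 (by omega))
  have h3 := abs_sub_abs_le_abs_sub (altSum d ((d : ℤ) - l) k s)
    (altSumLimit ((d : ℤ) - l) (d + 1) s / (k : ℝ) ^ (l + 1))
  rw [abs_div, abs_of_pos (by positivity : (0 : ℝ) < (k : ℝ) ^ (l + 1))] at h3
  rw [add_div]
  linarith

/-- A polynomial of degree at most `d` is annihilated by the `(d + 1)`-st difference, so that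
`ω` is an exact root of the part of the eliminant due to the first `d + 1` jumps. -/
lemma altSum_zero {d l : ℕ} (hl : l ≤ d) (k : ℕ) : altSum d ((d : ℤ) - l) k 0 = 0 := by
  have h := congrFun (fwdDiff_iter_pow_eq_zero_of_lt (R := ℝ)
    (show d - l < d + 1 by omega)) (k : ℝ)
  rw [fwdDiff_iter_eq_sum_shift] at h
  have hs : altSum d ((d : ℤ) - l) k 0 = (-1) ^ (d + 1) *
      ∑ j ∈ Finset.range (d + 1 + 1), ((-1 : ℤ) ^ (d + 1 - j) * ((d + 1).choose j : ℤ)) •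
        ((k : ℝ) + j • (1 : ℝ)) ^ (d - l) := by
    rw [altSum, Finset.mul_sum]
    refine Finset.sum_congr rfl fun j hj => ?_
    obtain ⟨e, he⟩ := Nat.exists_eq_add_of_le (Nat.lt_succ_iff.1 (Finset.mem_range.1 hj))
    rw [show (d : ℤ) - l = ((d - l : ℕ) : ℤ) by omega, zpow_natCast, he, Nat.add_sub_cancel_left]
    have : (-1 : ℝ) ^ (j + e) * (-1) ^ e = (-1) ^ j := by
      rw [pow_add, mul_assoc, ← mul_pow]; simp
    rw [← this]
    simp
    ring
  rw [hs, h]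
  simp

open Polynomial in
/-- The limit polynomial for the leading term is `X L_d^{(1)}` up to a constant. -/
lemma altSumLimit_eq_eval (d : ℕ) (s : ℝ) :
    altSumLimit d (d + 1) s
      = (((1 - derivative : ℝ[X] →ₗ[ℝ] ℝ[X]) ^ d) (X ^ (d + 1))).eval s := by
  have hdf : ∀ a : ℕ, ∏ i ∈ Finset.range a, (((d : ℤ) : ℝ) - i) = (d.descFactorial a : ℝ) := by
    intro a
    rw [← descPochhammer_eval_eq_descFactorial, descPochhammer_eval_eq_prod_range]
    rfl
  rw [one_sub_derivative_pow_X_pow, eval_finsetSum, altSumLimit, Finset.sum_range_succ, hdf,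
    Nat.descFactorial_of_lt (Nat.lt_succ_self d)]
  simp only [Nat.cast_zero, mul_zero, add_zero]
  refine Finset.sum_congr rfl fun a _ => ?_
  rw [hdf, Nat.descFactorial_eq_factorial_mul_choose, Nat.descFactorial_eq_factorial_mul_choose]
  simp only [eval_mul, eval_C, eval_pow, eval_X]
  push_cast
  ring

lemma exists_altSum_leading_bound {d : ℕ} {s : ℝ} (hs : altSumLimit d (d + 1) s = 0) :
    ∃ C : ℝ, 0 ≤ C ∧ ∀ k : ℕ, 1 ≤ k → |altSum d d k s| ≤ C / (k : ℝ) ^ 2 := by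
  obtain ⟨C, hC0, hC⟩ := exists_altSum_sub_bound d 0 s
  refine ⟨C, hC0, fun k hk => ?_⟩
  simpa [hs] using hC k hk

/-! ### The eliminant near the nodes -/

/-- The error term of `scaledCoeff` due to the smooth component. -/
lemma norm_scaled_smooth_le {d d₁ : ℕ} (hd : 2 * d + 1 ≤ d₁) {c : ℂ} {R : ℝ} {m k : ℕ}
    (hk : 1 ≤ k) (hkm : k ≤ m) (hc : ‖c‖ ≤ R / (m : ℝ) ^ (d₁ + 2)) :
    ‖2 * (Real.pi : ℂ) * (Complex.I * (m : ℂ)) ^ (d + 1) * c‖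
      ≤ 2 * Real.pi * R / (k : ℝ) ^ (d + 2) := by
  have hk0 : (0 : ℝ) < k := by exact_mod_cast hk
  have hkm' : (k : ℝ) ≤ m := by exact_mod_cast hkm
  have hm0 : (0 : ℝ) < m := hk0.trans_le hkm'
  have hm1 : (1 : ℝ) ≤ m := by exact_mod_cast hk.trans hkm
  have hR : 0 ≤ R := by
    by_contra h
    push Not at h
    exact absurd ((norm_nonneg c).trans hc) (not_le.2 (div_neg_of_neg_of_pos h (by positivity)))
  have hpi := Real.pi_pos
  simp only [norm_mul, norm_pow, Complex.norm_I, one_mul, Complex.norm_natCast, Complex.norm_real,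
    Complex.norm_ofNat, Real.norm_eq_abs, abs_of_pos hpi]
  calc 2 * Real.pi * (m : ℝ) ^ (d + 1) * ‖c‖
      ≤ 2 * Real.pi * (m : ℝ) ^ (d + 1) * (R / (m : ℝ) ^ (d₁ + 2)) := by gcongr
    _ ≤ 2 * Real.pi * (m : ℝ) ^ (d + 1) * (R / (m : ℝ) ^ ((d + 1) + (d + 2))) := by
        refine mul_le_mul_of_nonneg_left ?_ (by positivity)
        exact div_le_div_of_nonneg_left hR (by positivity) (pow_le_pow_right₀ hm1 (by omega))
    _ = 2 * Real.pi * R / (m : ℝ) ^ (d + 2) := by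
        rw [pow_add (m : ℝ) (d + 1)]
        field_simp
    _ ≤ 2 * Real.pi * R / (k : ℝ) ^ (d + 2) := by gcongr

/-- The scaled coefficients are `ω ^ m` times a sum of powers of `m`, up to the contribution of
the smooth component. -/
lemma scaledCoeff_eq {f : ℝ → ℝ} {ξ : ℝ} {d d₁ : ℕ} {A : ℕ → ℝ}
    (h : HasSingleJump f ξ d₁ A) {m : ℕ} (hm : m ≠ 0) :
    scaledCoeff d f m = jumpPoint ξ ^ m *
        ∑ l ∈ Finset.range (d₁ + 1), (A l : ℂ) * Complex.I ^ ((d : ℤ) - l) *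
          (m : ℂ) ^ ((d : ℤ) - l)
      + 2 * (Real.pi : ℂ) * (Complex.I * (m : ℂ)) ^ (d + 1) *
          fourierCoefficient (smoothPart f d₁ ξ A) (m : ℤ) := by
  have hpi : (Real.pi : ℂ) ≠ 0 := by exact_mod_cast Real.pi_ne_zero
  have hm' : (m : ℂ) ≠ 0 := by exact_mod_cast hm
  have hI := Complex.I_ne_zero
  rw [scaledCoeff, fourierCoefficient_eq_sum_add h hm, mul_add, Finset.mul_sum, Finset.mul_sum]
  congr 1
  refine Finset.sum_congr rfl fun l _ => ?_
  rw [mul_assoc (A l : ℂ), ← mul_zpow, zpow_sub₀ (mul_ne_zero hI hm'), zpow_natCast, zpow_natCast,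
    pow_succ _ l, pow_succ _ d]
  have : Complex.I * (m : ℂ) ≠ 0 := mul_ne_zero hI hm'
  field_simp

lemma norm_sum_add_le_of_forall {ι : Type*} (s : Finset ι) (u : ι → ℂ) (v : ι → ℝ) (a : ℂ) (b : ℝ)
    (hu : ∀ i ∈ s, ‖u i‖ ≤ v i) (ha : ‖a‖ ≤ b) : ‖∑ i ∈ s, u i + a‖ ≤ ∑ i ∈ s, v i + b :=
  (norm_add_le _ _).trans (add_le_add (norm_sum_le_of_le _ hu) ha)

lemma norm_I_zpow (p : ℤ) : ‖Complex.I ^ p‖ = 1 := by simp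

/-- At the point `ω (1 + s / k)` the eliminant is controlled by the alternating sums of powers. -/
lemma norm_eval_eliminant_le {f : ℝ → ℝ} {ξ : ℝ} {d d₁ : ℕ} {A : ℕ → ℝ} {R : ℝ}
    (hd : 2 * d + 1 ≤ d₁) (h : HasSingleJump f ξ d₁ A)
    (hR : ∀ n : ℕ, 1 ≤ n → ‖fourierCoefficient (smoothPart f d₁ ξ A) (n : ℤ)‖
      ≤ R / (n : ℝ) ^ (d₁ + 2)) {k : ℕ} (hk : 1 ≤ k) (s : ℝ) :
    ‖(eliminant d f k).eval (jumpPoint ξ * ((1 + s / k : ℝ) : ℂ))‖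
      ≤ ∑ l ∈ Finset.range (d₁ + 1), |A l| * |altSum d ((d : ℤ) - l) k s|
        + (∑ j ∈ Finset.range (d + 2), ((d + 1).choose j : ℝ) * (1 + |s|) ^ (d + 1 - j)) *
          (2 * Real.pi * R / (k : ℝ) ^ (d + 2)) := by
  set x : ℝ := 1 + s / k with hx
  set ε : ℕ → ℂ := fun m => 2 * (Real.pi : ℂ) * (Complex.I * (m : ℂ)) ^ (d + 1) *
          fourierCoefficient (smoothPart f d₁ ξ A) (m : ℤ) with hε
  have hω := norm_jumpPoint ξ
  have hk1 : (1 : ℝ) ≤ k := by exact_mod_cast hk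
  have hxle : |x| ≤ 1 + |s| := by
    refine (abs_add_le _ _).trans ?_
    rw [abs_one, abs_div, abs_of_pos (by linarith : (0 : ℝ) < k)]
    gcongr
    exact div_le_self (abs_nonneg _) hk1
  have hev : (eliminant d f k).eval (jumpPoint ξ * (x : ℂ))
      = ∑ l ∈ Finset.range (d₁ + 1), jumpPoint ξ ^ (k + (d + 1)) * ((A l : ℂ) *
          Complex.I ^ ((d : ℤ) - l) * ((altSum d ((d : ℤ) - l) k s : ℝ) : ℂ))
        + ∑ j ∈ Finset.range (d + 2), (-1 : ℂ) ^ j * ((d + 1).choose j : ℂ) * ε (k + j) *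
            (jumpPoint ξ * (x : ℂ)) ^ (d + 1 - j) := by
    simp only [altSum, Complex.ofReal_sum, Finset.mul_sum]
    rw [Finset.sum_comm, ← Finset.sum_add_distrib, eliminant, Polynomial.eval_finsetSum]
    refine Finset.sum_congr rfl fun j hj => ?_
    have hj' := Nat.lt_succ_iff.1 (Finset.mem_range.1 hj)
    rw [Polynomial.eval_monomial, scaledCoeff_eq h (by omega), mul_add, add_mul]
    congr 1
    rw [Finset.mul_sum, Finset.mul_sum, Finset.sum_mul]
    refine Finset.sum_congr rfl fun l _ => ?_
    rw [show k + (d + 1) = (k + j) + (d + 1 - j) by omega, pow_add (jumpPoint ξ), mul_pow]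
    rw [← hx]
    push_cast
    ring
  rw [hev]
  refine norm_sum_add_le_of_forall _ _ _ _ _ (fun l _ => ?_) ?_
  · simp only [norm_mul, norm_pow, hω, one_pow, one_mul, norm_I_zpow, mul_one, Complex.norm_real,
      Real.norm_eq_abs]
    exact le_refl _
  · rw [Finset.sum_mul]
    refine norm_sum_le_of_le _ fun j _ => ?_
    have h1 := norm_scaled_smooth_le hd hk (Nat.le_add_right k j) (hR (k + j) (by omega))
    simp only [norm_mul, norm_pow, norm_neg, norm_one, one_pow, one_mul, Complex.norm_natCast, hω,
      Complex.norm_real, Real.norm_eq_abs]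
    have h2 : ‖ε (k + j)‖ ≤ 2 * Real.pi * R / (k : ℝ) ^ (d + 2) := h1
    calc ((d + 1).choose j : ℝ) * ‖ε (k + j)‖ * |x| ^ (d + 1 - j)
        ≤ ((d + 1).choose j : ℝ) * (2 * Real.pi * R / (k : ℝ) ^ (d + 2)) *
            (1 + |s|) ^ (d + 1 - j) := by
          have := (norm_nonneg _).trans h2
          gcongr
      _ = _ := by ring

lemma nonneg_of_forall_norm_le {d₁ : ℕ} {c : ℕ → ℂ} {R : ℝ}
    (hR : ∀ n : ℕ, 1 ≤ n → ‖c n‖ ≤ R / (n : ℝ) ^ (d₁ + 2)) : 0 ≤ R := by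
  have := (norm_nonneg _).trans (hR 1 le_rfl)
  simpa using this

lemma sum_abs_add_le_sizeH {d d₁ : ℕ} (hd : 2 * d + 1 ≤ d₁) (A : ℕ → ℝ) (R : ℝ) :
    ∑ l ∈ Finset.range (d₁ + 1), |A l| + R ≤ sizeH d d₁ A R := by
  have h1 : ∑ l ∈ Finset.range (d₁ + 1), |A l|
      = ∑ l ∈ Finset.Icc 0 d, |A l| + ∑ l ∈ Finset.Icc (d + 1) d₁, |A l| := by
    have e1 : Finset.range (d₁ + 1) = Finset.Icc 0 d ∪ Finset.Icc (d + 1) d₁ := by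
      ext l; simp only [Finset.mem_range, Finset.mem_union, Finset.mem_Icc]; omega
    rw [e1, Finset.sum_union]
    rw [Finset.disjoint_left]
    intro l
    simp only [Finset.mem_Icc]
    omega
  rw [h1, sizeH]
  have := le_max_right 1 (∑ l ∈ Finset.Icc 0 d, |A l|)
  have := le_max_right 1 (∑ l ∈ Finset.Icc (d + 1) d₁, |A l|)
  linarith

lemma two_le_sizeH {d d₁ : ℕ} (A : ℕ → ℝ) {R : ℝ} (hR : 0 ≤ R) : 2 ≤ sizeH d d₁ A R := by
  rw [sizeH]
  have := le_max_left 1 (∑ l ∈ Finset.Icc 0 d, |A l|)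
  have := le_max_left 1 (∑ l ∈ Finset.Icc (d + 1) d₁, |A l|)
  linarith

/-- If every alternating sum is `O(k ^ (-e))` at `s`, the eliminant at `ω (1 + s / k)` is
`O(H k ^ (-e))`. -/
lemma exists_eval_eliminant_bound {d d₁ e : ℕ} (hd : 2 * d + 1 ≤ d₁) (he : e ≤ d + 2) (s : ℝ)
    (hs : ∀ l : ℕ, ∃ C : ℝ, 0 ≤ C ∧ ∀ k : ℕ, 1 ≤ k →
      |altSum d ((d : ℤ) - l) k s| ≤ C / (k : ℝ) ^ e) :
    ∃ B : ℝ, 0 ≤ B ∧ ∀ (f : ℝ → ℝ) (ξ : ℝ) (A : ℕ → ℝ) (R : ℝ), HasSingleJump f ξ d₁ A →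
      (∀ n : ℕ, 1 ≤ n → ‖fourierCoefficient (smoothPart f d₁ ξ A) (n : ℤ)‖
        ≤ R / (n : ℝ) ^ (d₁ + 2)) → ∀ k : ℕ, 1 ≤ k →
      ‖(eliminant d f k).eval (jumpPoint ξ * ((1 + s / k : ℝ) : ℂ))‖
        ≤ B * sizeH d d₁ A R / (k : ℝ) ^ e := by
  choose C hC0 hC using hs
  set M : ℝ := ∑ j ∈ Finset.range (d + 2), ((d + 1).choose j : ℝ) * (1 + |s|) ^ (d + 1 - j) with hM
  have hM0 : 0 ≤ M := by positivity
  have hS0 : 0 ≤ ∑ l ∈ Finset.range (d₁ + 1), C l := Finset.sum_nonneg fun l _ => hC0 l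
  have hpi := Real.pi_pos
  set B : ℝ := ∑ l ∈ Finset.range (d₁ + 1), C l + M * (2 * Real.pi) with hB
  have hB0 : 0 ≤ B := by positivity
  refine ⟨B, hB0, fun f ξ A R h hR k hk => ?_⟩
  have hR0 := nonneg_of_forall_norm_le hR
  have hk1 : (1 : ℝ) ≤ k := by exact_mod_cast hk
  have hk0 : (0 : ℝ) < k := by linarith
  refine (norm_eval_eliminant_le hd h hR hk s).trans ?_
  have h1 : ∀ l ∈ Finset.range (d₁ + 1), |A l| * |altSum d ((d : ℤ) - l) k s|
      ≤ |A l| * (B / (k : ℝ) ^ e) := by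
    intro l hl
    refine mul_le_mul_of_nonneg_left ((hC l k hk).trans ?_) (abs_nonneg _)
    have : C l ≤ ∑ l ∈ Finset.range (d₁ + 1), C l :=
      Finset.single_le_sum (fun i _ => hC0 i) hl
    have : C l ≤ B := by rw [hB]; linarith [mul_nonneg hM0 (by positivity : 0 ≤ 2 * Real.pi)]
    gcongr
  have h2 : M * (2 * Real.pi * R / (k : ℝ) ^ (d + 2)) ≤ R * (B / (k : ℝ) ^ e) := by
    calc M * (2 * Real.pi * R / (k : ℝ) ^ (d + 2))
        ≤ M * (2 * Real.pi * R / (k : ℝ) ^ e) := by gcongr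
      _ = R * ((M * (2 * Real.pi)) / (k : ℝ) ^ e) := by ring
      _ ≤ R * (B / (k : ℝ) ^ e) := by
          gcongr
          rw [hB]; linarith
  calc _ ≤ ∑ l ∈ Finset.range (d₁ + 1), |A l| * (B / (k : ℝ) ^ e) + R * (B / (k : ℝ) ^ e) :=
        add_le_add (Finset.sum_le_sum h1) h2
    _ = (∑ l ∈ Finset.range (d₁ + 1), |A l| + R) * (B / (k : ℝ) ^ e) := by
        rw [add_mul, Finset.sum_mul]
    _ ≤ sizeH d d₁ A R * (B / (k : ℝ) ^ e) := by
        have := sum_abs_add_le_sizeH hd A R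
        gcongr
    _ = _ := by ring

/-- Bound at the rescaled roots of the limit polynomial. -/
lemma exists_eval_eliminant_bound_of_limit_eq_zero {d d₁ : ℕ} (hd : 2 * d + 1 ≤ d₁) {s : ℝ}
    (hs : altSumLimit d (d + 1) s = 0) :
    ∃ B : ℝ, 0 ≤ B ∧ ∀ (f : ℝ → ℝ) (ξ : ℝ) (A : ℕ → ℝ) (R : ℝ), HasSingleJump f ξ d₁ A →
      (∀ n : ℕ, 1 ≤ n → ‖fourierCoefficient (smoothPart f d₁ ξ A) (n : ℤ)‖
        ≤ R / (n : ℝ) ^ (d₁ + 2)) → ∀ k : ℕ, 1 ≤ k →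
      ‖(eliminant d f k).eval (jumpPoint ξ * ((1 + s / k : ℝ) : ℂ))‖
        ≤ B * sizeH d d₁ A R / (k : ℝ) ^ 2 := by
  refine exists_eval_eliminant_bound hd (by omega) s fun l => ?_
  cases l with
  | zero => simpa using exists_altSum_leading_bound hs
  | succ l =>
    obtain ⟨C, hC0, hC⟩ := exists_altSum_bound d (l + 1) s
    refine ⟨C, hC0, fun k hk => (hC k hk).trans ?_⟩
    have hk1 : (1 : ℝ) ≤ k := by exact_mod_cast hk
    exact div_le_div_of_nonneg_left hC0 (by positivity) (pow_le_pow_right₀ hk1 (by omega))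

/-- The improved bound at the jump point itself. -/
lemma exists_eval_eliminant_jumpPoint_bound {d d₁ : ℕ} (hd : 2 * d + 1 ≤ d₁) :
    ∃ B : ℝ, 0 ≤ B ∧ ∀ (f : ℝ → ℝ) (ξ : ℝ) (A : ℕ → ℝ) (R : ℝ), HasSingleJump f ξ d₁ A →
      (∀ n : ℕ, 1 ≤ n → ‖fourierCoefficient (smoothPart f d₁ ξ A) (n : ℤ)‖
        ≤ R / (n : ℝ) ^ (d₁ + 2)) → ∀ k : ℕ, 1 ≤ k →
      ‖(eliminant d f k).eval (jumpPoint ξ)‖ ≤ B * sizeH d d₁ A R / (k : ℝ) ^ (d + 2) := by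
  obtain ⟨B, hB0, hB⟩ := exists_eval_eliminant_bound (e := d + 2) hd le_rfl 0 fun l => by
    rcases Nat.lt_or_ge d l with hl | hl
    · obtain ⟨C, hC0, hC⟩ := exists_altSum_bound d l 0
      refine ⟨C, hC0, fun k hk => (hC k hk).trans ?_⟩
      have hk1 : (1 : ℝ) ≤ k := by exact_mod_cast hk
      exact div_le_div_of_nonneg_left hC0 (by positivity) (pow_le_pow_right₀ hk1 (by omega))
    · exact ⟨0, le_rfl, fun k _ => by simp [altSum_zero hl k]⟩
  refine ⟨B, hB0, fun f ξ A R h hR k hk => ?_⟩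
  simpa using hB f ξ A R h hR k hk

lemma coeff_eliminant (d : ℕ) (f : ℝ → ℝ) (k : ℕ) :
    (eliminant d f k).coeff (d + 1) = scaledCoeff d f k := by
  rw [eliminant, Polynomial.finsetSum_coeff, Finset.sum_eq_single 0]
  · simp
  · intro j hj hj0
    rw [Polynomial.coeff_monomial, if_neg (by omega)]
  · simp

lemma natDegree_eliminant_le (d : ℕ) (f : ℝ → ℝ) (k : ℕ) :
    (eliminant d f k).natDegree ≤ d + 1 := by
  refine Polynomial.natDegree_sum_le_of_forall_le _ _ fun j _ => ?_
  exact (Polynomial.natDegree_monomial_le _).trans (Nat.sub_le _ _)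

/-- The leading coefficient of the eliminant is dominated by the contribution of `A 0`. -/
lemma le_norm_scaledCoeff {f : ℝ → ℝ} {ξ : ℝ} {d d₁ : ℕ} {A : ℕ → ℝ} {R J : ℝ}
    (hd : 2 * d + 1 ≤ d₁) (h : HasSingleJump f ξ d₁ A) (hJ : J ≤ |A 0|)
    (hR : ∀ n : ℕ, 1 ≤ n → ‖fourierCoefficient (smoothPart f d₁ ξ A) (n : ℤ)‖
      ≤ R / (n : ℝ) ^ (d₁ + 2)) {k : ℕ} (hk : 1 ≤ k)
    (hkJ : 4 * Real.pi * sizeH d d₁ A R ≤ J * k) :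
    J / 2 * (k : ℝ) ^ d ≤ ‖scaledCoeff d f k‖ := by
  have hk1 : (1 : ℝ) ≤ k := by exact_mod_cast hk
  have hk0 : (0 : ℝ) < k := by linarith
  have hR0 := nonneg_of_forall_norm_le hR
  have hpi := Real.pi_gt_three
  have hε := norm_scaled_smooth_le hd hk le_rfl (hR k hk)
  set ε : ℂ := 2 * (Real.pi : ℂ) * (Complex.I * (k : ℂ)) ^ (d + 1) *
    fourierCoefficient (smoothPart f d₁ ξ A) (k : ℤ)
  have hterm : ∀ l : ℕ, ‖jumpPoint ξ ^ k * ((A l : ℂ) * Complex.I ^ ((d : ℤ) - l) *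
      (k : ℂ) ^ ((d : ℤ) - l))‖ = |A l| * (k : ℝ) ^ ((d : ℤ) - l) := by
    intro l
    simp only [norm_mul, norm_pow, norm_jumpPoint, one_pow, one_mul, norm_I_zpow, mul_one,
      Complex.norm_real, Real.norm_eq_abs]
    rw [norm_zpow, Complex.norm_natCast]
  have hrest : ‖∑ l ∈ Finset.range d₁, jumpPoint ξ ^ k * ((A (l + 1) : ℂ) *
      Complex.I ^ ((d : ℤ) - (l + 1 : ℕ)) * (k : ℂ) ^ ((d : ℤ) - (l + 1 : ℕ))) + ε‖
      ≤ ∑ l ∈ Finset.range d₁, |A (l + 1)| * ((k : ℝ) ^ d / k)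
        + 2 * Real.pi * R * ((k : ℝ) ^ d / k) := by
    refine norm_sum_add_le_of_forall _ _ _ _ _ (fun l _ => ?_) (hε.trans ?_)
    · rw [hterm]
      refine mul_le_mul_of_nonneg_left ?_ (abs_nonneg _)
      calc (k : ℝ) ^ ((d : ℤ) - (l + 1 : ℕ)) ≤ (k : ℝ) ^ ((d : ℤ) - 1) :=
            zpow_le_zpow_right₀ hk1 (by push_cast; omega)
        _ = _ := by rw [zpow_sub₀ hk0.ne', zpow_natCast, zpow_one]
    · rw [div_eq_mul_inv]
      refine mul_le_mul_of_nonneg_left ?_ (by positivity)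
      calc ((k : ℝ) ^ (d + 2))⁻¹ ≤ ((k : ℝ) ^ 1)⁻¹ := by
            exact inv_anti₀ (by positivity) (pow_le_pow_right₀ hk1 (by omega))
        _ = 1 / k := by rw [pow_one, one_div]
        _ ≤ (k : ℝ) ^ d / k := by
            gcongr
            exact one_le_pow₀ hk1
  have hsplit : scaledCoeff d f k = jumpPoint ξ ^ k * ((A 0 : ℂ) *
      Complex.I ^ ((d : ℤ) - (0 : ℕ)) * (k : ℂ) ^ ((d : ℤ) - (0 : ℕ))) +
      (∑ l ∈ Finset.range d₁, jumpPoint ξ ^ k * ((A (l + 1) : ℂ) *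
        Complex.I ^ ((d : ℤ) - (l + 1 : ℕ)) * (k : ℂ) ^ ((d : ℤ) - (l + 1 : ℕ))) + ε) := by
    rw [scaledCoeff_eq h (show k ≠ 0 by omega), Finset.mul_sum, Finset.sum_range_succ', add_assoc,
      add_left_comm]
  have h1 := norm_sub_le_norm_add
    (jumpPoint ξ ^ k * ((A 0 : ℂ) * Complex.I ^ ((d : ℤ) - (0 : ℕ)) *
      (k : ℂ) ^ ((d : ℤ) - (0 : ℕ))))
    (∑ l ∈ Finset.range d₁, jumpPoint ξ ^ k * ((A (l + 1) : ℂ) *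
      Complex.I ^ ((d : ℤ) - (l + 1 : ℕ)) * (k : ℂ) ^ ((d : ℤ) - (l + 1 : ℕ))) + ε)
  rw [← hsplit, hterm, Nat.cast_zero, sub_zero, zpow_natCast] at h1
  have hH := sum_abs_add_le_sizeH hd A R
  rw [Finset.sum_range_succ'] at hH
  have h2 : ∑ l ∈ Finset.range d₁, |A (l + 1)| + 2 * Real.pi * R
      ≤ 2 * Real.pi * sizeH d d₁ A R := by
    have hS : 0 ≤ ∑ l ∈ Finset.range d₁, |A (l + 1)| :=
      Finset.sum_nonneg fun _ _ => abs_nonneg _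
    have := abs_nonneg (A 0)
    nlinarith
  have h3 : (∑ l ∈ Finset.range d₁, |A (l + 1)| + 2 * Real.pi * R) * ((k : ℝ) ^ d / k)
      ≤ J / 2 * (k : ℝ) ^ d := by
    calc _ ≤ (J * k / 2) * ((k : ℝ) ^ d / k) := by
          gcongr
          linarith
      _ = _ := by field_simp
  rw [← Finset.sum_mul, ← add_mul] at hrest
  have h4 : J * (k : ℝ) ^ d ≤ |A 0| * (k : ℝ) ^ d := by gcongr
  linarith

/-! ### Matching roots with separated nodes -/

/-- If `n + 1` nodes have norms separated by `δ`, and at each node the product of the distances to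
the points `κ` (listed by increasing norm) is small, then the `i`-th point lies near the `i`-th
node, and all the other points stay away from that node. -/
lemma norm_sub_mul_le_of_prod_le {n : ℕ} {y κ : Fin (n + 1) → ℂ} {δ : ℝ} {E : Fin (n + 1) → ℝ}
    (hδ : 0 < δ) (hy : ∀ i j, i < j → ‖y i‖ + δ ≤ ‖y j‖) (hκ : Monotone fun i => ‖κ i‖)
    (hE : ∀ i, ∏ j, ‖y i - κ j‖ ≤ E i) (hEδ : ∀ i, E i < (δ / 4) ^ (n + 1)) (i : Fin (n + 1)) :
    ‖y i - κ i‖ < δ / 4 ∧ ‖y i - κ i‖ * (δ / 2) ^ n ≤ E i := by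
  have hnear : ∀ i, ∃ j, ‖y i - κ j‖ < δ / 4 := by
    intro i
    by_contra! hcon
    refine absurd (hEδ i) (not_lt.2 (le_trans ?_ (hE i)))
    calc (δ / 4) ^ (n + 1) = ∏ _j : Fin (n + 1), δ / 4 := by
          rw [Finset.prod_const, Finset.card_univ, Fintype.card_fin]
      _ ≤ _ := Finset.prod_le_prod (fun _ _ => by positivity) fun j _ => hcon j
  choose σ hσ using hnear
  have hσm : StrictMono σ := by
    intro i j hij
    by_contra! hle
    have h1 := hκ hle
    have h2 := norm_sub_norm_le (κ (σ i)) (y i)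
    have h3 := norm_sub_norm_le (y j) (κ (σ j))
    rw [norm_sub_rev] at h2
    have h4 := hy i j hij
    have h5 := hσ i
    have h6 := hσ j
    simp only at h1
    linarith
  have hid : σ = id := hσm.eq_id
  subst hid
  simp only [id] at hσ
  refine ⟨hσ i, le_trans ?_ (hE i)⟩
  rw [Fin.prod_univ_succAbove _ i]
  refine mul_le_mul_of_nonneg_left ?_ (norm_nonneg _)
  calc (δ / 2) ^ n = ∏ _j : Fin n, δ / 2 := by
        rw [Finset.prod_const, Finset.card_univ, Fintype.card_fin]
    _ ≤ _ := Finset.prod_le_prod (fun _ _ => by positivity) fun j _ => ?_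
  have hne : i ≠ i.succAbove j := (Fin.succAbove_ne i j).symm
  set m := i.succAbove j
  have hsep : δ ≤ ‖y i - y m‖ := by
    rcases lt_or_gt_of_ne hne with hlt | hlt
    · have := hy _ _ hlt
      have h2 := norm_sub_norm_le (y m) (y i)
      rw [norm_sub_rev] at h2
      linarith
    · have := hy _ _ hlt
      have h2 := norm_sub_norm_le (y i) (y m)
      linarith
  have h1 := norm_sub_le_norm_sub_add_norm_sub (y i) (κ m) (y m)
  have h2 := hσ m
  rw [norm_sub_rev] at h2
  linarith

lemma norm_eval_eq_prod {p : Polynomial ℂ} {n : ℕ} {κ : Fin n → ℂ}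
    (hκ : p.roots = Multiset.map κ Finset.univ.val) (z : ℂ) :
    ‖p.eval z‖ = ‖p.leadingCoeff‖ * ∏ j, ‖z - κ j‖ := by
  have h := (IsAlgClosed.splits p).eq_prod_roots
  rw [hκ, Multiset.map_map] at h
  conv_lhs => rw [h]
  rw [Polynomial.eval_mul, Polynomial.eval_C, norm_mul, ← Finset.prod_eq_multiset_prod,
    Polynomial.eval_prod, norm_prod]
  simp

/-- Replacing the node `ω / (1 - a / k)` by `ω (1 + a / k)` costs only `O(k ^ (-2))`, within the
accuracy claimed for the outer roots. -/
lemma norm_invT_sub_le {ω : ℂ} (hω : ‖ω‖ = 1) {a : ℝ} {k : ℕ} (hk : 1 ≤ k)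
    (ha : 0 ≤ a) (hak : 2 * a ≤ k) :
    ‖ω * ((1 + a / k : ℝ) : ℂ) - invT ω (-(a : ℂ) / (k : ℂ))‖ ≤ 2 * a ^ 2 / (k : ℝ) ^ 2 := by
  have hk0 : (0 : ℝ) < k := by exact_mod_cast hk
  have hu : a / k ≤ 1 / 2 := by rw [div_le_iff₀ hk0]; linarith
  have hu0 : 0 ≤ a / k := by positivity
  have h1 : invT ω (-(a : ℂ) / (k : ℂ)) = ω * (((1 - a / k)⁻¹ : ℝ) : ℂ) := by
    rw [invT, div_eq_mul_inv]
    push_cast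
    congr 2
    ring
  rw [h1, ← mul_sub, ← Complex.ofReal_sub, norm_mul, hω, one_mul, Complex.norm_real,
    Real.norm_eq_abs]
  set u := a / k with hu'
  have hpos : 0 < 1 - u := by linarith
  have h2 : 1 + u - (1 - u)⁻¹ = -(u ^ 2 / (1 - u)) := by field_simp; ring
  rw [h2, abs_neg, abs_of_nonneg (by positivity), mul_div_assoc, ← div_pow, ← hu',
    div_le_iff₀ hpos]
  nlinarith [sq_nonneg u]

end FourierJump

end

/-! ### Location of the jump -/

theorem mainTheorem1 (d : ℕ) :
    ∃ φ : Fin d → ℝ,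
      (FourierJump.laguerre 1 d).roots = Multiset.map φ Finset.univ.val ∧
      StrictMono (fun i => |φ i|) ∧
      ∃ c : ℝ, 0 < c ∧
        ∀ d₁ : ℕ, 2 * d + 1 ≤ d₁ → ∀ J : ℝ, 0 < J →
          ∃ C₀ C₁ K : ℝ, 0 < C₀ ∧ 0 < C₁ ∧ 0 < K ∧
            ∀ (f : ℝ → ℝ) (ξ : ℝ) (A : ℕ → ℝ) (R : ℝ),
              ξ ∈ Set.Icc (-Real.pi) Real.pi →
              FourierJump.HasSingleJump f ξ d₁ A →
              J ≤ |A 0| →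
              (∀ n : ℕ, 1 ≤ n →
                ‖FourierJump.fourierCoefficient (FourierJump.smoothPart f d₁ ξ A) (n : ℤ)‖
                  ≤ R / (n : ℝ) ^ (d₁ + 2)) →
              ∀ k : ℕ, K * FourierJump.sizeH d d₁ A R < (k : ℝ) →
                (∀ i, ∃ t : ℝ, 1 ≤ t ∧
                  FourierJump.node (FourierJump.jumpPoint ξ) φ k i
                    = (t : ℂ) * FourierJump.jumpPoint ξ) ∧
                (∀ i j, i < j →
                  c / (k : ℝ) ≤ ‖FourierJump.node (FourierJump.jumpPoint ξ) φ k i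
                    - FourierJump.node (FourierJump.jumpPoint ξ) φ k j‖) ∧
                (FourierJump.eliminant d f k).natDegree = d + 1 ∧
                ∀ κ : Fin (d + 1) → ℂ,
                  (FourierJump.eliminant d f k).roots = Multiset.map κ Finset.univ.val →
                  Monotone (fun i => ‖κ i‖) →
                  (∀ i : Fin d,
                    ‖κ i.succ - FourierJump.node (FourierJump.jumpPoint ξ) φ k i.succ‖
                      ≤ C₁ * FourierJump.sizeH d d₁ A R / (k : ℝ) ^ 2) ∧
                  ‖κ 0 - FourierJump.jumpPoint ξ‖
                    ≤ C₀ * FourierJump.sizeH d d₁ A R / (k : ℝ) ^ (d + 2) ∧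
                  ∀ w : ℂ, FourierJump.IsLocationEstimate d f k w →
                    w = κ 0 ∧
                    ‖w - FourierJump.jumpPoint ξ‖
                      ≤ C₀ * FourierJump.sizeH d d₁ A R / (k : ℝ) ^ (d + 2) := by
  open FourierJump in
  obtain ⟨φ, hφm, hφ0, hφr, hφz⟩ := exists_roots_laguerre d
  have habs : (fun i => |φ i|) = φ := funext fun i => abs_of_pos (hφ0 i)
  refine ⟨φ, hφr, by rw [habs]; exact hφm, ?_⟩
  -- `a` lists all roots of the limit polynomial, the root `0` first.
  set a : Fin (d + 1) → ℝ := Fin.cons 0 φ with ha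
  have ha0 : ∀ i, 0 ≤ a i := Fin.cases (by simp [ha]) fun i => by simpa [ha] using (hφ0 i).le
  have haz : a 0 = 0 := rfl
  have hasucc : ∀ i : Fin d, a i.succ = φ i := fun i => rfl
  have ham : StrictMono a := Fin.strictMono_cons.2 ⟨hφ0, hφm⟩
  obtain ⟨δ, hδ0, hδ⟩ : ∃ δ : ℝ, 0 < δ ∧ ∀ i j, i < j → a i + δ ≤ a j := by
    have hev : ∀ᶠ δ in nhdsWithin (0 : ℝ) (Set.Ioi 0), ∀ i j, i < j → δ < a j - a i := by
      refine Filter.eventually_all.2 fun i => Filter.eventually_all.2 fun j => ?_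
      by_cases hij : i < j
      · filter_upwards [nhdsWithin_le_nhds (gt_mem_nhds (sub_pos.2 (ham hij)))] with δ h _ using h
      · exact Filter.Eventually.of_forall fun δ h => absurd h hij
    obtain ⟨δ, h1, h2⟩ := (hev.and self_mem_nhdsWithin).exists
    exact ⟨δ, h2, fun i j hij => by linarith [h1 i j hij]⟩
  obtain ⟨M, hM⟩ : ∃ M : ℝ, ∀ i, a i ≤ M := by
    obtain ⟨M, hM⟩ := (Set.finite_range a).bddAbove
    exact ⟨M, fun i => hM ⟨i, rfl⟩⟩
  have hM0 : 0 ≤ M := (ha0 0).trans (hM 0)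
  refine ⟨δ, hδ0, fun d₁ hd₁ J hJ => ?_⟩
  have hlim : ∀ i, altSumLimit d (d + 1) (a i) = 0 := by
    intro i
    rw [altSumLimit_eq_eval]
    refine Fin.cases ?_ (fun i => hφz i) i
    rw [haz, ← X_mul_laguerre]
    simp
  choose B₁ hB₁0 hB₁ using fun i =>
    exists_eval_eliminant_bound_of_limit_eq_zero hd₁ (hlim i)
  obtain ⟨B₀, hB₀0, hB₀⟩ := exists_eval_eliminant_jumpPoint_bound (d := d) hd₁
  obtain ⟨B, hB0, hBB₀, hBB₁⟩ : ∃ B : ℝ, 0 < B ∧ B₀ ≤ B ∧ ∀ i, B₁ i ≤ B := by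
    refine ⟨1 + B₀ + ∑ i, B₁ i, ?_, ?_, fun i => ?_⟩
    · have := Finset.sum_nonneg fun i (_ : i ∈ Finset.univ) => hB₁0 i
      linarith
    · have := Finset.sum_nonneg fun i (_ : i ∈ Finset.univ) => hB₁0 i
      linarith
    · have := Finset.single_le_sum (fun i _ => hB₁0 i) (Finset.mem_univ i)
      linarith
  have hpi := Real.pi_pos
  -- The three summands of `K` make the leading coefficient large, the products of distances small
  -- against the separation of the nodes, and the first-order approximation of the nodes valid.
  set D : ℝ := 2 * B / J with hD
  have hDpos : 0 < D := by positivity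
  refine ⟨D * (2 / δ) ^ d, D * (2 / δ) ^ d + M ^ 2, 4 * Real.pi / J + D * (4 / δ) ^ (d + 1)
    + (M + 1), by positivity, by positivity, by positivity, ?_⟩
  intro f ξ A R _ hf hJA hR k hkK
  set H := sizeH d d₁ A R with hH
  set ω := jumpPoint ξ with hωdef
  have hω : ‖ω‖ = 1 := norm_jumpPoint ξ
  have hH2 : 2 ≤ H := two_le_sizeH A (nonneg_of_forall_norm_le hR)
  have hH0 : 0 < H := by linarith
  have hK1 : 0 < 4 * Real.pi / J * H := by positivity
  have hK2 : 0 < D * (4 / δ) ^ (d + 1) * H := by positivity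
  have hK3 : 0 ≤ M * H := by positivity
  rw [add_mul, add_mul, add_mul M] at hkK
  have hk2 : (2 : ℝ) ≤ k := by linarith
  have hk0 : (0 : ℝ) < k := by linarith
  have hk1 : 1 ≤ k := by exact_mod_cast (by linarith : (1 : ℝ) ≤ k)
  have hMk : 2 * M ≤ k := by nlinarith
  have hlead : J / 2 * (k : ℝ) ^ d ≤ ‖scaledCoeff d f k‖ := by
    refine le_norm_scaledCoeff hd₁ hf hJA hR hk1 ?_
    have : 4 * Real.pi / J * H ≤ k := by linarith
    rw [div_mul_eq_mul_div, div_le_iff₀ hJ] at this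
    linarith
  have hleadpos : 0 < J / 2 * (k : ℝ) ^ d := by positivity
  have hdeg : (eliminant d f k).natDegree = d + 1 := by
    refine le_antisymm (natDegree_eliminant_le d f k) (Polynomial.le_natDegree_of_ne_zero ?_)
    rw [coeff_eliminant]
    exact norm_pos_iff.1 (hleadpos.trans_le hlead)
  have hLC : (eliminant d f k).leadingCoeff = scaledCoeff d f k := by
    rw [Polynomial.leadingCoeff, hdeg, coeff_eliminant]
  have huk : ∀ i, a i / k ≤ 1 / 2 := by
    intro i
    rw [div_le_iff₀ hk0]
    linarith [hM i]
  have hnode : ∀ i, node ω φ k i = (((1 - a i / k)⁻¹ : ℝ) : ℂ) * ω := by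
    intro i
    refine Fin.cases ?_ (fun i => ?_) i
    · simp [node, haz]
    · rw [node, Fin.cons_succ, hasucc, invT, div_eq_mul_inv, mul_comm]
      push_cast
      congr 2
      ring
  refine ⟨fun i => ⟨(1 - a i / k)⁻¹, ?_, hnode i⟩, fun i j hij => ?_, hdeg, fun κ hκ hκm => ?_⟩
  · refine (one_le_inv₀ (by linarith [huk i])).2 ?_
    have : 0 ≤ a i / k := div_nonneg (ha0 i) hk0.le
    linarith
  · rw [hnode, hnode, ← sub_mul, norm_mul, hω, mul_one, ← Complex.ofReal_sub, Complex.norm_real,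
      Real.norm_eq_abs, abs_sub_comm]
    refine le_trans ?_ (le_abs_self _)
    have hi := huk i
    have hj := huk j
    have hi0 : 0 ≤ a i / k := div_nonneg (ha0 i) hk0.le
    have hij' : a i / k + δ / k ≤ a j / k := by
      rw [← add_div]; exact div_le_div_of_nonneg_right (hδ i j hij) hk0.le
    have hδk : 0 < δ / k := by positivity
    set u := a i / k
    set v := a j / k
    rw [inv_sub_inv (by linarith) (by linarith), le_div_iff₀ (by nlinarith)]
    have : (1 - u) * (1 - v) ≤ 1 := mul_le_one₀ (by linarith) (by linarith) (by linarith)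
    nlinarith
  -- The eliminant is evaluated at these first-order approximations of the nodes.
  set y : Fin (d + 1) → ℂ := fun i => ω * ((1 + a i / k : ℝ) : ℂ) with hy
  have hynorm : ∀ i, ‖y i‖ = 1 + a i / k := by
    intro i
    have : 0 ≤ a i / k := div_nonneg (ha0 i) hk0.le
    simp only [hy]
    rw [norm_mul, hω, one_mul, Complex.norm_real, Real.norm_eq_abs, abs_of_nonneg (by linarith)]
  have hysep : ∀ i j, i < j → ‖y i‖ + δ / k ≤ ‖y j‖ := by
    intro i j hij
    rw [hynorm, hynorm, add_assoc, ← add_div]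
    gcongr
    exact hδ i j hij
  have hprod : ∀ (z : ℂ) (e : ℕ), ‖(eliminant d f k).eval z‖ ≤ B * H / (k : ℝ) ^ e →
      ∏ j, ‖z - κ j‖ ≤ D * H / (k : ℝ) ^ (e + d) := by
    intro z e hz
    rw [norm_eval_eq_prod hκ, hLC] at hz
    have h1 : J / 2 * (k : ℝ) ^ d * ∏ j, ‖z - κ j‖ ≤ B * H / (k : ℝ) ^ e :=
      (mul_le_mul_of_nonneg_right hlead (Finset.prod_nonneg fun _ _ => norm_nonneg _)).trans hz
    rw [mul_comm, ← le_div_iff₀ hleadpos] at h1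
    refine h1.trans (le_of_eq ?_)
    rw [hD, pow_add]
    field_simp
  have hE : ∀ i, ∏ j, ‖y i - κ j‖ ≤ D * H / (k : ℝ) ^ (2 + d) := by
    intro i
    refine hprod _ 2 ((hB₁ i f ξ A R hf hR k hk1).trans ?_)
    gcongr
    exact hBB₁ i
  have hEδ : D * H / (k : ℝ) ^ (2 + d) < (δ / k / 4) ^ (d + 1) := by
    have h1 : D * (4 / δ) ^ (d + 1) * H < k := by nlinarith
    have h2 : D * H < k * (δ / 4) ^ (d + 1) := by
      have h3 : (4 / δ) ^ (d + 1) * (δ / 4) ^ (d + 1) = 1 := by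
        rw [← mul_pow]; field_simp; simp
      calc D * H = D * (4 / δ) ^ (d + 1) * H * (δ / 4) ^ (d + 1) := by
            linear_combination (-(D * H)) * h3
        _ < _ := by gcongr
    rw [div_lt_iff₀ (by positivity)]
    calc D * H < k * (δ / 4) ^ (d + 1) := h2
      _ = _ := by
        rw [show δ / k / 4 = δ / 4 / k by ring, div_pow _ (k : ℝ), show 2 + d = d + 1 + 1 by ring,
          pow_succ (k : ℝ) (d + 1)]
        field_simp
  have hmatch := norm_sub_mul_le_of_prod_le (by positivity : 0 < δ / k) hysep hκm hE fun _ => hEδ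
  -- Division by the product of the distances to the other roots.
  have hrefine : ∀ (i : Fin (d + 1)) (e : ℕ),
      ‖y i - κ i‖ * (δ / k / 2) ^ d ≤ D * H / (k : ℝ) ^ (e + d) →
      ‖κ i - y i‖ ≤ D * (2 / δ) ^ d * H / (k : ℝ) ^ e := by
    intro i e h
    rw [norm_sub_rev]
    rw [← le_div_iff₀ (by positivity)] at h
    refine h.trans (le_of_eq ?_)
    simp only [div_pow, pow_add]
    field_simp
  have hy0 : y 0 = ω := by simp [hy, haz]
  have hκ0 : ‖κ 0 - ω‖ ≤ D * (2 / δ) ^ d * H / (k : ℝ) ^ (d + 2) := by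
    have h1 : ∀ i, ∏ j, ‖y i - κ j‖
        ≤ if i = 0 then D * H / (k : ℝ) ^ (d + 2 + d) else D * H / (k : ℝ) ^ (2 + d) := by
      intro i
      split_ifs with hi
      · subst hi
        rw [hy0]
        refine hprod _ (d + 2) ((hB₀ f ξ A R hf hR k hk1).trans ?_)
        gcongr
      · exact hE i
    have h2 : ∀ i : Fin (d + 1),
        (if i = 0 then D * H / (k : ℝ) ^ (d + 2 + d) else D * H / (k : ℝ) ^ (2 + d))
          < (δ / k / 4) ^ (d + 1) := by
      intro i
      split_ifs
      · refine lt_of_le_of_lt ?_ hEδ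
        gcongr
        · linarith
        · omega
      · exact hEδ
    have h3 := (norm_sub_mul_le_of_prod_le (by positivity : 0 < δ / k) hysep hκm h1 h2 0).2
    rw [if_pos rfl] at h3
    have h4 := hrefine 0 (d + 2) h3
    rwa [hy0] at h4
  refine ⟨fun i => ?_, hκ0, fun w hw => ?_⟩
  · have h1 := hrefine i.succ 2 (hmatch i.succ).2
    have h2 : ‖y i.succ - node ω φ k i.succ‖ ≤ 2 * a i.succ ^ 2 / (k : ℝ) ^ 2 :=
      norm_invT_sub_le hω hk1 (ha0 i.succ) (by linarith [hM i.succ])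
    have h3 : 2 * a i.succ ^ 2 / (k : ℝ) ^ 2 ≤ M ^ 2 * H / (k : ℝ) ^ 2 := by
      have : a i.succ ^ 2 ≤ M ^ 2 := by
        have := ha0 i.succ
        have := hM i.succ
        gcongr
      refine div_le_div_of_nonneg_right ?_ (by positivity)
      nlinarith [sq_nonneg M]
    have h4 := norm_sub_le_norm_sub_add_norm_sub (κ i.succ) (y i.succ) (node ω φ k i.succ)
    rw [add_mul, add_div]
    linarith
  · have hw0 : w = κ 0 := by
      have hne : eliminant d f k ≠ 0 := by
        intro h0
        rw [h0] at hdeg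
        simp at hdeg
      have hroot : ∀ i, (eliminant d f k).IsRoot (κ i) := by
        intro i
        rw [← Polynomial.mem_roots hne, hκ]
        exact Multiset.mem_map_of_mem _ (Finset.mem_univ i)
      have hmem := (Polynomial.mem_roots hne).2 hw.1
      rw [hκ, Multiset.mem_map] at hmem
      obtain ⟨i, -, rfl⟩ := hmem
      by_contra hi
      have hi0 : 0 < i := Fin.pos_iff_ne_zero.2 fun h => hi (by rw [h])
      have h1 := hw.2 _ (hroot 0)
      have h2 := abs_norm_sub_norm_le (κ 0) (y 0)
      have h3 := (hmatch 0).1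
      rw [hynorm, haz, zero_div, add_zero, norm_sub_rev] at h2
      have h4 := norm_sub_norm_le (y i) (κ i)
      have h5 := (hmatch i).1
      have h6 := hysep 0 i hi0
      rw [hynorm 0, haz, zero_div, add_zero] at h6
      have h7 := le_abs_self (‖κ i‖ - 1)
      have h8 : 0 < δ / k := by positivity
      linarith
    exact ⟨hw0, by rw [hw0]; exact hκ0⟩
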